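/- **Setting.** Fermion fields $\Phi_I$, $I\in\iota$, have operator products $\Phi_I(z)\Phi_J(w)=\frac{S_{IJ}}{z-w}+\mathrm{reg}$. Three cases are considered: $\iota=\{\psi^*_1,\dots,\psi^*_N,\psi_1,\dots,\psi_N\}$ with $\psi^*_\alpha\psi_\beta\sim\frac{\delta_{\alpha\beta}}{z-w}$, for $G=GL(N,\mathbb C)$ and for $G=O(2N,\mathbb C)$, and the same fields together with one more real fermion $\Psi$, $\Psi\Psi\sim\frac1{z-w}$, for $G=O(2N+1,\mathbb C)$. Let $\mathfrak h$ be the diagonal Cartan subalgebra: all diagonal matrices for $GL(N)$, $\mathrm{diag}(x,-x)$ for $O(2N)$ and $\mathrm{diag}(x,-x,0)$ for $O(2N+1)$. Let $\mathrm N_G(\mathfrak h)=\{g\in G:\ g\mathfrak hg^{-1}=\mathfrak h\}$. An element $g\in \mathrm N_G(\mathfrak h)$ determines the $g$-twisted fermions. For $O(n)$ their monodromy is $\Phi_I(e^{2\pi i}z)=\sum_J g_{IJ}\Phi_J(z)$. For $GL(N)$ it is $\psi^*_\alpha\mapsto\sum_\beta g_{\alpha\beta}\psi^*_\beta$, $\psi_\alpha\mapsto\sum_\beta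 (g^{-1})_{\beta\alpha}\psi_\beta$. For a row vector $v$ put $\Phi_v=\sum_I v_I\Phi_I$. A field $\Phi_v$ with monodromy eigenvalue $\mu$ has modes $\Phi_v(z)=\sum_p\Phi_{v,p}z^{-p-1/2}$, $e^{-2\pi i(p+1/2)}=\mu$, with $\{\Phi_{v,p},\Phi_{w,p'}\}=vSw^{T}\,\delta_{p+p',0}$. Let $\mathcal F_g$ be the Fock module of these modes generated by a ground state annihilated by the modes with $p>0$ (that is, $\mathrm{Re}\,p>0$, or $\mathrm{Re}\,p=0$ and $\mathrm{Im}\,p>0$) and by the modes $\Phi_{v,0}$ with $v$ in a maximal isotropic subspace $L$ of the space of coefficient vectors of zero modes (for $GL(N)$: by all zero modes of the fields $\psi$). It is graded by fermion parity $(-1)^F$, the ground state being even, and carries $L_0$ with $[L_0,\Phi_{v,p}]=-p\,\Phi_{v,p}$; for $GL(N)$ it also carries the total charge $J_0$, with $[J_0,\psi^*_p]=\psi^*_p$ and $[J_0,\psi_p]=-\psi_p$. The ground state eigenvalues are fixed by point splitting: a pair of conjugate fields with monodromies $e^{\pm2\pi i\theta}$ and ground-state two-point function $z^{\theta}w^{-\theta}/(z-w)$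 contributes $\theta^2/2$ to $L_0$ and, for $GL(N)$, $\theta$ to $J_0$; an unpaired real fermion with monodromy $1$ or $-1$ contributes $0$ or $\frac1{16}$ to $L_0$. The data $\dot g$, the modules $\mathcal H_{\dot g}$ and conjugacy in $G$ are as follows. * $GL(N)$: $\dot g=(g,t)$ with $e^{t}=\det g$ (so $t$ is a value of $\mathrm{tr}\log g$), and $\mathcal H_{\dot g}\subset\mathcal F_g$ is the eigenspace of $J_0$ with eigenvalue $t/2\pi i$. $\dot g_1\sim\dot g_2$ means that $g_1=\Omega g_2\Omega^{-1}$ for some $\Omega\in GL(N)$ and $t_1=t_2$. * $O(2N)$: $\dot g$ consists of $g$ and one of the two parity components $\mathcal H_{\dot g}$ of $\mathcal F_g$. $\dot g_1\sim\dot g_2$ means that $g_1=\Omega g_2\Omega^{-1}$ for some $\Omega\in O(2N)$ such that the field transformation $\Phi_v\mapsto\Phi_{v\Omega}$ carries the first component to the second one; explicitly, the parities $\varepsilon_1,\varepsilon_2$ of the components relative to the ground states defined by $L_1,L_2$ satisfy $\varepsilon_2\equiv\varepsilon_1+\dim\big(L_1\Omega/(L_1\Omega\cap L_2)\big)\pmod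 2$. * $O(2N+1)$: $\dot g=g$ and $\mathcal H_{\dot g}=\mathcal F_g$. $\dot g_1\sim\dot g_2$ means that $g_1=\Omega g_2\Omega^{-1}$ for some $\Omega\in O(2N+1)$. For $q=e^{2\pi i\tau}$, $\mathrm{Im}\,\tau>0$, and $q^x:=e^{2\pi i\tau x}$, put $\chi_{\dot g}(q)=\mathrm{tr}_{\mathcal H_{\dot g}}q^{L_0}$. For $O(2N+1)$ there are two characters, $\chi^+_{\dot g}(q)=\mathrm{tr}\,q^{L_0}$ and $\chi^-_{\dot g}(q)=\mathrm{tr}\,(-1)^Fq^{L_0}$. **Theorem.** (a) Let $G$ be $GL(N)$, $O(2N)$ or $O(2N+1)$, and let $\dot g_1,\dot g_2$, coming from $g_1,g_2\in\mathrm N_G(\mathfrak h)$, be conjugate in $G$. Then $\mathcal H_{\dot g_1}$ and $\mathcal H_{\dot g_2}$ have well-defined characters ($L_0$ is diagonalizable with finite-dimensional eigenspaces, and the traces converge absolutely for $\mathrm{Im}\,\tau>0$), and $\chi_{\dot g_1}(q)=\chi_{\dot g_2}(q)$; for $O(2N+1)$, $\chi^{\pm}_{\dot g_1}(q)=\chi^{\pm}_{\dot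 g_2}(q)$. In the orthogonal cases this holds for all choices of the subspaces $L_1$, $L_2$. (b) The following theta-function identity holds. Let $l_1,\dots,l_K\ge1$ be integers, $N=l_1+\dots+l_K$, $r_1,\dots,r_K\in\mathbb C$, and let $v\in\mathbb C^N$ be the vector with components $r_i+\frac{1-l_i+2j}{2l_i}$, $1\le i\le K$, $0\le j\le l_i-1$. Then for $\mathrm{Im}\,\tau>0$ $$\frac{\sum_{k\in\mathbb Z^N,\ k_1+\ldots+k_N=0}q^{\frac12\sum_{s=1}^N(v_s+k_s)^2}}{\eta(q)^N}=\frac{\sum_{n\in\mathbb Z^K,\ n_1+\ldots+n_K=0}q^{\sum_{i=1}^K\frac1{2l_i}(n_i+l_ir_i)^2}}{\prod_{i=1}^K\eta(q^{1/l_i})},$$ both sums being absolutely convergent; here $\eta(q)=q^{1/24}\prod_{n\ge1}(1-q^n)$. -/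

import Mathlib

noncomputable section

namespace TwistFields

/-! ### Fermionic Fock modules -/

section Clifford

variable {M : Type} [AddCommGroup M] [Module ℂ M]

/-- The left ideal of the Clifford algebra generated by a space `P` of annihilation operators. -/
def vacIdeal (Q : QuadraticForm ℂ M) (P : Submodule ℂ M) :
    Submodule (CliffordAlgebra Q) (CliffordAlgebra Q) :=
  Submodule.span _ ((fun f => CliffordAlgebra.ι Q f) '' (P : Set M))

/-- The Fock module: the left module over the Clifford algebra generated by a ground state (the
class of `1`) whose only relations are that the elements of `P` annihilate it. -/
abbrev Fock (Q : QuadraticForm ℂ M) (P : Submodule ℂ M) : Type :=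
  CliffordAlgebra Q ⧸ vacIdeal Q P

/-- The class in the Fock module of an element of the Clifford algebra (that is, the result of
its action on the ground state), as a `ℂ`-linear map. -/
def fockMk (Q : QuadraticForm ℂ M) (P : Submodule ℂ M) : CliffordAlgebra Q →ₗ[ℂ] Fock Q P :=
  (vacIdeal Q P).mkQ.restrictScalars ℂ

/-- The part of the Fock module of fermion parity `ε`: the vectors obtained from the ground state
by an even (`ε = 0`) or odd (`ε = 1`) element of the Clifford algebra. -/
def fockParity (Q : QuadraticForm ℂ M) (P : Submodule ℂ M) (ε : ZMod 2) :
    Submodule ℂ (Fock Q P) :=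
  (CliffordAlgebra.evenOdd Q ε).map (fockMk Q P)

/-- The infinitesimal isometries of `Q`. -/
def IsSkew (Q : QuadraticForm ℂ M) (A : Module.End ℂ M) : Prop :=
  ∀ f, QuadraticMap.polar Q f (A f) = 0

/-- Auxiliary: `x ↦ x + ε D(x)` into the dual numbers over the Clifford algebra. -/
def dualLift (Q : QuadraticForm ℂ M) (A : Module.End ℂ M) (hA : IsSkew Q A) :
    CliffordAlgebra Q →ₐ[ℂ] TrivSqZeroExt (CliffordAlgebra Q) (CliffordAlgebra Q) :=
  CliffordAlgebra.lift Q
    ⟨{ toFun := fun f => TrivSqZeroExt.inl (CliffordAlgebra.ι Q f)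
          + TrivSqZeroExt.inr (CliffordAlgebra.ι Q (A f))
       map_add' := by intro f g; ext <;> simp
       map_smul' := by intro c f; ext <;> simp },
     by
      intro f
      have h : CliffordAlgebra.ι Q f * CliffordAlgebra.ι Q (A f)
          + CliffordAlgebra.ι Q (A f) * CliffordAlgebra.ι Q f = 0 := by
        rw [CliffordAlgebra.ι_mul_ι_add_swap, hA f, map_zero]
      ext
      · simp [TrivSqZeroExt.algebraMap_eq_inl']
      · simpa [TrivSqZeroExt.algebraMap_eq_inl'] using h⟩

/-- The derivation of the Clifford algebra that extends an infinitesimal isometry. -/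
def cliffordDer (Q : QuadraticForm ℂ M) (A : Module.End ℂ M) (hA : IsSkew Q A) :
    Module.End ℂ (CliffordAlgebra Q) :=
  (TrivSqZeroExt.sndHom (CliffordAlgebra Q) (CliffordAlgebra Q)).restrictScalars ℂ
    ∘ₗ (dualLift Q A hA).toLinearMap

lemma dualLift_fst (Q : QuadraticForm ℂ M) (A : Module.End ℂ M) (hA : IsSkew Q A)
    (x : CliffordAlgebra Q) : (dualLift Q A hA x).fst = x := by
  have h : (TrivSqZeroExt.fstHom ℂ (CliffordAlgebra Q) (CliffordAlgebra Q)).comp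
      (dualLift Q A hA) = AlgHom.id ℂ _ := by
    apply CliffordAlgebra.hom_ext
    ext f
    simp [dualLift]
  exact congrArg (fun φ => φ x) h

lemma cliffordDer_ι (Q : QuadraticForm ℂ M) (A : Module.End ℂ M) (hA : IsSkew Q A) (f : M) :
    cliffordDer Q A hA (CliffordAlgebra.ι Q f) = CliffordAlgebra.ι Q (A f) := by
  simp [cliffordDer, dualLift]

lemma cliffordDer_mul (Q : QuadraticForm ℂ M) (A : Module.End ℂ M) (hA : IsSkew Q A)
    (x y : CliffordAlgebra Q) :
    cliffordDer Q A hA (x * y) = x * cliffordDer Q A hA y + cliffordDer Q A hA x * y := by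
  simp [cliffordDer, dualLift_fst]

lemma cliffordDer_mem (Q : QuadraticForm ℂ M) (P : Submodule ℂ M) (A : Module.End ℂ M)
    (hA : IsSkew Q A) (hP : ∀ f ∈ P, A f ∈ P) :
    (vacIdeal Q P).restrictScalars ℂ ≤
      ((vacIdeal Q P).restrictScalars ℂ).comap (cliffordDer Q A hA) := by
  intro x hx
  simp only [Submodule.mem_comap, Submodule.restrictScalars_mem] at *
  refine Submodule.span_induction ?_ ?_ ?_ ?_ hx
  · rintro _ ⟨f, hf, rfl⟩
    simp only [cliffordDer_ι]
    exact Submodule.subset_span ⟨A f, hP f hf, rfl⟩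
  · simp
  · intro x y _ _ h h'
    rw [map_add]
    exact add_mem h h'
  · intro a x hx h
    rw [smul_eq_mul, cliffordDer_mul]
    exact add_mem (Submodule.smul_mem _ a h) (Submodule.smul_mem _ _ hx)

/-- The second quantization of an infinitesimal isometry `A` that preserves the annihilation
operators: the operator on the Fock module that kills the ground state and whose commutator with
(the action of) a generator `f` is `A f`. -/
def secondQuant (Q : QuadraticForm ℂ M) (P : Submodule ℂ M) (A : Module.End ℂ M)
    (hA : IsSkew Q A) (hP : ∀ f ∈ P, A f ∈ P) : Module.End ℂ (Fock Q P) :=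
  (Submodule.Quotient.restrictScalarsEquiv ℂ (vacIdeal Q P)).toLinearMap
    ∘ₗ ((vacIdeal Q P).restrictScalars ℂ).mapQ ((vacIdeal Q P).restrictScalars ℂ)
        (cliffordDer Q A hA) (cliffordDer_mem Q P A hA hP)
    ∘ₗ (Submodule.Quotient.restrictScalarsEquiv ℂ (vacIdeal Q P)).symm.toLinearMap

lemma secondQuant_ground (Q : QuadraticForm ℂ M) (P : Submodule ℂ M) (A : Module.End ℂ M)
    (hA : IsSkew Q A) (hP : ∀ f ∈ P, A f ∈ P) :
    secondQuant Q P A hA hP (fockMk Q P 1) = 0 := by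
  have h : cliffordDer Q A hA 1 = 0 := by simp [cliffordDer]
  change fockMk Q P (cliffordDer Q A hA 1) = 0
  rw [h, map_zero]

lemma secondQuant_smul (Q : QuadraticForm ℂ M) (P : Submodule ℂ M) (A : Module.End ℂ M)
    (hA : IsSkew Q A) (hP : ∀ f ∈ P, A f ∈ P) (f : M) (x : Fock Q P) :
    secondQuant Q P A hA hP (CliffordAlgebra.ι Q f • x)
      = CliffordAlgebra.ι Q f • secondQuant Q P A hA hP x + CliffordAlgebra.ι Q (A f) • x := by
  obtain ⟨y, rfl⟩ := (vacIdeal Q P).mkQ_surjective x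
  change fockMk Q P (cliffordDer Q A hA (CliffordAlgebra.ι Q f * y)) = _
  rw [cliffordDer_mul, cliffordDer_ι, map_add]
  rfl

end Clifford

/-! ### Twisted free fermions

`ι` labels a basis `Φ_I` of the fermion fields, with operator product
`Φ_I(z) Φ_J(w) = S_{IJ} / (z - w) + regular`.  A matrix `D` with `D S Dᵀ = S` prescribes the
monodromy `Φ_I(e^{2πi} z) = ∑_J D_{IJ} Φ_J(z)`.  With `Φ_v = ∑_I v_I Φ_I` for a row vector `v`, this
reads `Φ_v(e^{2πi} z) = Φ_{v D}(z)`. -/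

section Twisted

variable {ι : Type} [Fintype ι]

/-- The space of modes of the twisted fields.  If `v D = μ v`, then
`Φ_v(z) = ∑_p Φ_{v,p} z ^ (-p - 1/2)`, the sum being over the complex `p` with
`exp (-2πi (p + 1/2)) = μ`, that is, with `v D = - exp (-2πi p) v`.  The function `f` with finite
support stands for the mode `∑_p Φ_{f p, p}`. -/
def modeSpace (D : Matrix ι ι ℂ) : Submodule ℂ (ℂ →₀ (ι → ℂ)) where
  carrier := {f | ∀ p : ℂ, Matrix.vecMul (f p) D
    = (-Complex.exp (-(2 * Real.pi * Complex.I * p))) • f p}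
  zero_mem' := by intro p; simp
  add_mem' := by
    intro f g hf hg p
    simp only [Finsupp.add_apply, Matrix.add_vecMul, smul_add, hf p, hg p]
  smul_mem' := by
    intro c f hf p
    simp only [Finsupp.smul_apply, Matrix.smul_vecMul, hf p]
    rw [smul_comm]

/-- The space of modes as a type. -/
def Mode (D : Matrix ι ι ℂ) : Type := modeSpace D

instance (D : Matrix ι ι ℂ) : AddCommGroup (Mode D) := inferInstanceAs (AddCommGroup (modeSpace D))

instance (D : Matrix ι ι ℂ) : Module ℂ (Mode D) := inferInstanceAs (Module ℂ (modeSpace D))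

lemma Mode.add_val {D : Matrix ι ι ℂ} (f g : Mode D) : (f + g).1 = f.1 + g.1 := rfl

lemma Mode.smul_val {D : Matrix ι ι ℂ} (c : ℂ) (f : Mode D) : (c • f).1 = c • f.1 := rfl

lemma Mode.zero_val {D : Matrix ι ι ℂ} : (0 : Mode D).1 = 0 := rfl

lemma Mode.ext' {D : Matrix ι ι ℂ} {f g : Mode D} (h : ∀ p, f.1 p = g.1 p) : f = g :=
  Subtype.ext (Finsupp.ext h)

/-- The anticommutator `{Φ_{v,p}, Φ_{w,p'}} = (v S wᵀ) δ_{p + p', 0}`, extended bilinearly. -/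
def modeForm (S D : Matrix ι ι ℂ) : LinearMap.BilinForm ℂ (Mode D) :=
  LinearMap.mk₂ ℂ
    (fun f g => f.1.sum fun p v => dotProduct (Matrix.vecMul v S) (g.1 (-p)))
    (by
      intro f f' g
      exact Finsupp.sum_add_index' (by simp) (by simp [Matrix.add_vecMul, add_dotProduct]))
    (by
      intro c f g
      rw [Mode.smul_val, Finsupp.sum_smul_index' (by simp), Finsupp.smul_sum]
      simp [Matrix.smul_vecMul, smul_dotProduct])
    (by
      intro f g g'
      simp [Mode.add_val, Finsupp.sum, dotProduct_add, Finset.sum_add_distrib])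
    (by
      intro c f g
      simp [Mode.smul_val, Finsupp.sum, dotProduct_smul, Finset.mul_sum])

/-- The quadratic form `Φ ↦ Φ² = ½ {Φ, Φ}` on the modes.  Its Clifford algebra is the algebra of
the twisted fermions. -/
def modeQuad (S D : Matrix ι ι ℂ) : QuadraticForm ℂ (Mode D) :=
  (2⁻¹ : ℂ) • LinearMap.BilinMap.toQuadraticMap (modeForm S D)

/-- A mode index counts as positive when its real part is positive; purely imaginary indices
are ordered by their imaginary part. -/
def ModePos (p : ℂ) : Prop := 0 < p.re ∨ (p.re = 0 ∧ 0 < p.im)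

/-- The coefficient vectors of the zero modes: those `v` with `v D = - v`. -/
def zeroModes (D : Matrix ι ι ℂ) : Submodule ℂ (ι → ℂ) where
  carrier := {v | Matrix.vecMul v D = -v}
  zero_mem' := by simp
  add_mem' := by
    intro v w hv hw
    change Matrix.vecMul (v + w) D = -(v + w)
    rw [Matrix.add_vecMul, show Matrix.vecMul v D = -v from hv,
      show Matrix.vecMul w D = -w from hw, neg_add]
  smul_mem' := by
    intro c v hv
    change Matrix.vecMul (c • v) D = -(c • v)
    rw [Matrix.smul_vecMul, show Matrix.vecMul v D = -v from hv, smul_neg]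

/-- `L` is a maximal isotropic space of zero modes. -/
def IsZeroModePolarization (S D : Matrix ι ι ℂ) (L : Submodule ℂ (ι → ℂ)) : Prop :=
  Maximal (fun L' : Submodule ℂ (ι → ℂ) => L' ≤ zeroModes D ∧
    ∀ v ∈ L', ∀ w ∈ L', dotProduct (Matrix.vecMul v S) w = 0) L

/-- The modes that annihilate the ground state: all modes of positive index, and the zero modes
whose coefficient vector lies in `L`. -/
def annihilators (D : Matrix ι ι ℂ) (L : Submodule ℂ (ι → ℂ)) : Submodule ℂ (Mode D) where
  carrier := {f | f.1 0 ∈ L ∧ ∀ p : ℂ, p ≠ 0 → ¬ ModePos p → f.1 p = 0}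
  zero_mem' := by simp [Mode.zero_val]
  add_mem' := by
    rintro f g ⟨hf, hf'⟩ ⟨hg, hg'⟩
    refine ⟨by simpa [Mode.add_val] using L.add_mem hf hg, fun p hp hp' => ?_⟩
    simp [Mode.add_val, hf' p hp hp', hg' p hp hp']
  smul_mem' := by
    rintro c f ⟨hf, hf'⟩
    refine ⟨by simpa [Mode.smul_val] using L.smul_mem c hf, fun p hp hp' => ?_⟩
    simp [Mode.smul_val, hf' p hp hp']

/-- The Fock module of the `D`-twisted fermions.  If `S` is nondegenerate, `D` is diagonalizable and
`L` is a maximal isotropic space of zero modes, this is the (up to isomorphism and change of parity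
unique) irreducible `ℤ/2`-graded module with energy bounded from below. -/
abbrev TwistedFock (S D : Matrix ι ι ℂ) (L : Submodule ℂ (ι → ℂ)) : Type :=
  Fock (modeQuad S D) (annihilators D L)

lemma modeForm_eq_sum (S D : Matrix ι ι ℂ) (f g : Mode D) (s : Finset ℂ)
    (hs : f.1.support ⊆ s) :
    modeForm S D f g = ∑ p ∈ s, dotProduct (Matrix.vecMul (f.1 p) S) (g.1 (-p)) :=
  Finsupp.sum_of_support_subset f.1 hs
    (fun p v => dotProduct (Matrix.vecMul v S) (g.1 (-p))) (by simp)

lemma isSkew_of_termwise {S D : Matrix ι ι ℂ} {A : Module.End ℂ (Mode D)}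
    (h : ∀ (f : Mode D) (p : ℂ), dotProduct (Matrix.vecMul (f.1 p) S) ((A f).1 (-p))
      + dotProduct (Matrix.vecMul ((A f).1 p) S) (f.1 (-p)) = 0) :
    IsSkew (modeQuad S D) A := by
  classical
  intro f
  have h2 : modeForm S D f (A f) + modeForm S D (A f) f = 0 := by
    rw [modeForm_eq_sum S D f (A f) (f.1.support ∪ (A f).1.support) Finset.subset_union_left,
      modeForm_eq_sum S D (A f) f (f.1.support ∪ (A f).1.support) Finset.subset_union_right,
      ← Finset.sum_add_distrib]
    exact Finset.sum_eq_zero fun p _ => h f p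
  have h3 : ∀ x : Mode D, modeQuad S D x = (2⁻¹ : ℂ) * modeForm S D x x := fun x => rfl
  simp only [QuadraticMap.polar, h3, map_add, LinearMap.add_apply]
  linear_combination (2⁻¹ : ℂ) * h2

/-- The map `Φ_{v,p} ↦ - p Φ_{v,p}` on modes. -/
def energyMap (D : Matrix ι ι ℂ) : Module.End ℂ (Mode D) where
  toFun f := ⟨Finsupp.onFinset f.1.support (fun p => (-p) • f.1 p)
      (by intro p hp; rw [Finsupp.mem_support_iff]; intro h; exact hp (by simp [h])), by
    intro p
    simp only [Finsupp.onFinset_apply, Matrix.smul_vecMul, f.2 p]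
    rw [smul_comm]⟩
  map_add' := by
    intro f g
    refine Mode.ext' fun p => ?_
    change (-p) • (f.1 p + g.1 p) = (-p) • f.1 p + (-p) • g.1 p
    rw [smul_add]
  map_smul' := by
    intro c f
    refine Mode.ext' fun p => ?_
    change (-p) • c • f.1 p = c • (-p) • f.1 p
    rw [smul_comm]

lemma energyMap_skew (S D : Matrix ι ι ℂ) : IsSkew (modeQuad S D) (energyMap D) := by
  apply isSkew_of_termwise
  intro f p
  change dotProduct (Matrix.vecMul (f.1 p) S) ((- -p) • f.1 (-p))
      + dotProduct (Matrix.vecMul ((-p) • f.1 p) S) (f.1 (-p)) = 0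
  rw [neg_neg, Matrix.smul_vecMul, smul_dotProduct, dotProduct_smul, ← add_smul, add_neg_cancel,
    zero_smul]

lemma energyMap_annihilators (D : Matrix ι ι ℂ) (L : Submodule ℂ (ι → ℂ)) :
    ∀ f ∈ annihilators D L, energyMap D f ∈ annihilators D L := by
  rintro f ⟨hf, hf'⟩
  refine ⟨?_, fun p hp hp' => ?_⟩
  · change (-(0 : ℂ)) • f.1 0 ∈ L
    simp
  · change (-p) • f.1 p = 0
    rw [hf' p hp hp', smul_zero]

/-- The logarithm `θ` of an eigenvalue `μ = e^{2πiθ}` of the monodromy for which the modes of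
positive index of a field `Φ` with monodromy `μ` are exactly those with `p ∈ 1/2 - θ + ℕ`.  (It
satisfies `-1/2 ≤ Re θ ≤ 1/2`.) -/
def twistExponent (μ : ℂ) : ℂ :=
  if Complex.arg μ = Real.pi ∧ ‖μ‖ ≤ 1 then Complex.log μ / (2 * Real.pi * Complex.I) - 1
  else Complex.log μ / (2 * Real.pi * Complex.I)

variable [DecidableEq ι]

/-- The conformal weight of the ground state.  A pair of conjugate fields with monodromies
`e^{± 2πiθ}` has the two-point function `z ^ θ w ^ (-θ) / (z - w)` in the ground state and so, by
point splitting, contributes `θ² / 2`; hence each eigenvalue of `D` contributes `θ² / 4`. -/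
def groundWeight (D : Matrix ι ι ℂ) : ℂ :=
  (D.charpoly.roots.map fun μ => twistExponent μ ^ 2 / 4).sum

/-- The Virasoro operator `L₀` on the twisted Fock module: `[L₀, Φ_{v,p}] = - p Φ_{v,p}`, and the
ground state has the eigenvalue `groundWeight D`. -/
def L0 (S D : Matrix ι ι ℂ) (L : Submodule ℂ (ι → ℂ)) : Module.End ℂ (TwistedFock S D L) :=
  secondQuant (modeQuad S D) (annihilators D L) (energyMap D) (energyMap_skew S D)
      (energyMap_annihilators D L)
    + groundWeight D • LinearMap.id

end Twisted

/-! ### Characters -/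

section Character

variable {F : Type} [AddCommGroup F] [Module ℂ F]

/-- The space of vectors of weight `h` in `H`. -/
def weightSpace (T : Module.End ℂ F) (H : Submodule ℂ F) (h : ℂ) : Submodule ℂ F :=
  H ⊓ T.eigenspace h

/-- The trace of `q ^ T` over `H`, where `q ^ h = e^{2πiτh}`. -/
def character (T : Module.End ℂ F) (H : Submodule ℂ F) (τ : ℂ) : ℂ :=
  ∑' h : ℂ, (Module.finrank ℂ (weightSpace T H h) : ℂ)
    * Complex.exp (2 * Real.pi * Complex.I * τ * h)

/-- The character of `H` exists: `H` is spanned by eigenvectors of `T`, with finite multiplicities,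
and the trace of `q ^ T` converges absolutely on the upper half plane. -/
def HasCharacter (T : Module.End ℂ F) (H : Submodule ℂ F) : Prop :=
  (H = ⨆ h : ℂ, weightSpace T H h) ∧
  (∀ h : ℂ, FiniteDimensional ℂ (weightSpace T H h)) ∧
  ∀ τ : ℂ, 0 < τ.im → Summable fun h : ℂ => (Module.finrank ℂ (weightSpace T H h) : ℂ)
    * Complex.exp (2 * Real.pi * Complex.I * τ * h)

end Character

/-! ### The groups and their Cartan normalizers -/

section Groups

variable {ι : Type} [Fintype ι] [DecidableEq ι]

/-- The invertible matrices `g` with `g h g⁻¹ = h`. -/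
def cartanNormalizer (h : Set (Matrix ι ι ℂ)) : Set (GL ι ℂ) :=
  {g | (fun X => (g : Matrix ι ι ℂ) * X * ((g⁻¹ : GL ι ℂ) : Matrix ι ι ℂ)) '' h = h}

/-- The complex orthogonal group of the form `S`. -/
def orthogonal (S : Matrix ι ι ℂ) : Set (GL ι ℂ) :=
  {g | (g : Matrix ι ι ℂ) * S * (g : Matrix ι ι ℂ).transpose = S}

/-- The Cartan subalgebra of `𝔤𝔩(N)`: the diagonal matrices. -/
def cartanGL (N : ℕ) : Set (Matrix (Fin N) (Fin N) ℂ) := Set.range Matrix.diagonal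

/-- Index set of the fields `ψ*_1, …, ψ*_N, ψ_1, …, ψ_N`. -/
abbrev IdxD (N : ℕ) : Type := Fin N ⊕ Fin N

/-- Index set of the fields `ψ*_1, …, ψ*_N, ψ_1, …, ψ_N, Ψ`. -/
abbrev IdxB (N : ℕ) : Type := IdxD N ⊕ Unit

/-- The operator products `ψ*_α ψ_β ∼ δ_{αβ} / (z - w)`. -/
def formD (N : ℕ) : Matrix (IdxD N) (IdxD N) ℂ := Matrix.fromBlocks 0 1 1 0

/-- The same, with one more real fermion, `Ψ Ψ ∼ 1 / (z - w)`. -/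
def formB (N : ℕ) : Matrix (IdxB N) (IdxB N) ℂ := Matrix.fromBlocks (formD N) 0 0 1

/-- The Cartan subalgebra of `𝔰𝔬(2N)`: the matrices `diag(x, -x)`. -/
def cartanD (N : ℕ) : Set (Matrix (IdxD N) (IdxD N) ℂ) :=
  Set.range fun x : Fin N → ℂ => Matrix.diagonal (Sum.elim x (-x))

/-- The Cartan subalgebra of `𝔰𝔬(2N+1)`: the matrices `diag(x, -x, 0)`. -/
def cartanB (N : ℕ) : Set (Matrix (IdxB N) (IdxB N) ℂ) :=
  Set.range fun x : Fin N → ℂ => Matrix.diagonal (Sum.elim (Sum.elim x (-x)) 0)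

end Groups

/-! ### `G = GL(N)` -/

section GLN

variable {N : ℕ}

/-- The monodromy `ψ*_α ↦ ∑ g_{αβ} ψ*_β`, `ψ_α ↦ ∑ (g⁻¹)_{βα} ψ_β`. -/
def monodromyGL (g : GL (Fin N) ℂ) : Matrix (IdxD N) (IdxD N) ℂ :=
  Matrix.fromBlocks (g : Matrix (Fin N) (Fin N) ℂ) 0 0
    ((g⁻¹ : GL (Fin N) ℂ) : Matrix (Fin N) (Fin N) ℂ).transpose

/-- For `GL(N)` the zero modes of the fields `ψ` are taken to annihilate the ground state. -/
def zeroPolGL (g : GL (Fin N) ℂ) : Submodule ℂ (IdxD N → ℂ) :=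
  zeroModes (monodromyGL g) ⊓ LinearMap.ker (LinearMap.funLeft ℂ ℂ (Sum.inl : Fin N → IdxD N))

/-- The Fock module of the `g`-twisted charged fermions. -/
abbrev FockGL (g : GL (Fin N) ℂ) : Type := TwistedFock (formD N) (monodromyGL g) (zeroPolGL g)

/-- The map that is `1` on the coefficients of `ψ*` and `-1` on the coefficients of `ψ`. -/
def chargeVec (N : ℕ) : (IdxD N → ℂ) →ₗ[ℂ] (IdxD N → ℂ) where
  toFun v := Sum.elim (fun a => v (Sum.inl a)) (fun a => -v (Sum.inr a))
  map_add' := by intro v w; ext (a | a) <;> simp; ring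
  map_smul' := by intro c v; ext (a | a) <;> simp

lemma chargeVec_vecMul (g : GL (Fin N) ℂ) (v : IdxD N → ℂ) :
    Matrix.vecMul (chargeVec N v) (monodromyGL g)
      = chargeVec N (Matrix.vecMul v (monodromyGL g)) := by
  ext (a | a) <;>
    simp [Matrix.vecMul, dotProduct, monodromyGL, chargeVec]

lemma chargeVec_form (v w : IdxD N → ℂ) :
    dotProduct (Matrix.vecMul v (formD N)) (chargeVec N w)
      + dotProduct (Matrix.vecMul (chargeVec N v) (formD N)) w = 0 := by
  simp [Matrix.vecMul, dotProduct, formD, chargeVec, Matrix.one_apply]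
  ring

/-- The map `ψ* ↦ ψ*`, `ψ ↦ -ψ` on modes. -/
def chargeMap (g : GL (Fin N) ℂ) : Module.End ℂ (Mode (monodromyGL g)) where
  toFun f := ⟨f.1.mapRange (chargeVec N) (map_zero _), by
    intro p
    simp only [Finsupp.mapRange_apply]
    rw [chargeVec_vecMul, f.2 p, map_smul]⟩
  map_add' := by
    intro f g
    refine Mode.ext' fun p => ?_
    change chargeVec N (f.1 p + g.1 p) = chargeVec N (f.1 p) + chargeVec N (g.1 p)
    rw [map_add]
  map_smul' := by
    intro c f
    refine Mode.ext' fun p => ?_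
    change chargeVec N (c • f.1 p) = c • chargeVec N (f.1 p)
    rw [map_smul]

lemma chargeMap_skew (g : GL (Fin N) ℂ) :
    IsSkew (modeQuad (formD N) (monodromyGL g)) (chargeMap g) :=
  isSkew_of_termwise fun f p => chargeVec_form (f.1 p) (f.1 (-p))

lemma chargeMap_annihilators (g : GL (Fin N) ℂ) :
    ∀ f ∈ annihilators (monodromyGL g) (zeroPolGL g),
      chargeMap g f ∈ annihilators (monodromyGL g) (zeroPolGL g) := by
  rintro f ⟨⟨h1, h2⟩, h3⟩
  refine ⟨⟨?_, ?_⟩, fun p hp hp' => ?_⟩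
  · change Matrix.vecMul (chargeVec N (f.1 0)) (monodromyGL g) = -(chargeVec N (f.1 0))
    rw [chargeVec_vecMul, show Matrix.vecMul (f.1 0) (monodromyGL g) = -(f.1 0) from h1, map_neg]
  · exact h2
  · change chargeVec N (f.1 p) = 0
    rw [h3 p hp hp', map_zero]

/-- The total charge `J₀ = ∑_α J_{α,0}`: it has commutator `±1` with the modes of `ψ*` and `ψ`.
A pair `ψ*`, `ψ` with monodromies `e^{± 2πiθ}` contributes `θ` to the charge of the ground state,
again by point splitting of the two-point function `z ^ θ w ^ (-θ) / (z - w)`. -/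
def J0 (g : GL (Fin N) ℂ) : Module.End ℂ (FockGL g) :=
  secondQuant (modeQuad (formD N) (monodromyGL g)) (annihilators (monodromyGL g) (zeroPolGL g))
      (chargeMap g) (chargeMap_skew g) (chargeMap_annihilators g)
    + ((g : Matrix (Fin N) (Fin N) ℂ).charpoly.roots.map twistExponent).sum • LinearMap.id

/-- The datum `ġ = (g, tr log g)`: an element of the Cartan normalizer of `GL(N)` and a value `t`
of `tr log g`, that is, of `log det g`. -/
structure DotGL (N : ℕ) where
  g : GL (Fin N) ℂ
  mem : g ∈ cartanNormalizer (cartanGL N)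
  t : ℂ
  exp_t : Complex.exp t = (g : Matrix (Fin N) (Fin N) ℂ).det

/-- `ġ₁` and `ġ₂` are conjugate in `GL(N)`: conjugation leaves the value of `tr log g` unchanged. -/
def DotGL.Conj (a b : DotGL N) : Prop :=
  (∃ Ω : GL (Fin N) ℂ, a.g = Ω * b.g * Ω⁻¹) ∧ a.t = b.t

/-- The module `ℋ_ġ`: the subspace of the twisted Fock module of total charge `tr log g / 2πi`. -/
def DotGL.module (a : DotGL N) : Submodule ℂ (FockGL a.g) :=
  (J0 a.g).eigenspace (a.t / (2 * Real.pi * Complex.I))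

/-- `L₀` for the `g`-twisted charged fermions. -/
def DotGL.L0 (a : DotGL N) : Module.End ℂ (FockGL a.g) :=
  TwistFields.L0 (formD N) (monodromyGL a.g) (zeroPolGL a.g)

/-- The character `χ_ġ(q)`, `q = e^{2πiτ}`. -/
def DotGL.chi (a : DotGL N) (τ : ℂ) : ℂ := character a.L0 a.module τ

end GLN

/-! ### `G = O(2N)` -/

section ODD

variable {N : ℕ}

/-- The datum `ġ` for `O(2N)`: an element of the Cartan normalizer together with one of the two
isotypic components (for the group generated by `(-1)^F`) of the twisted fermion module.  The module
is presented through a polarization `L` of the zero modes; the component is then given by its parity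
relative to the corresponding ground state. -/
structure DotD (N : ℕ) where
  g : GL (IdxD N) ℂ
  mem_orthogonal : g ∈ orthogonal (formD N)
  mem : g ∈ cartanNormalizer (cartanD N)
  L : Submodule ℂ (IdxD N → ℂ)
  pol : IsZeroModePolarization (formD N) (g : Matrix (IdxD N) (IdxD N) ℂ) L
  parity : ZMod 2

/-- The ambient `g`-twisted Fock module. -/
abbrev DotD.FockSpace (a : DotD N) : Type :=
  TwistedFock (formD N) (a.g : Matrix (IdxD N) (IdxD N) ℂ) a.L

/-- `ġ₁` and `ġ₂` are conjugate in `O(2N)`: `g₁ = Ω g₂ Ω⁻¹`, and the transformation of the fields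
by `Ω`, `Φ_v ↦ Φ_{v Ω}`, carries the component `ġ₁` to the component `ġ₂`.  The ground state for `L₁`
goes to a ground state for `L₁ Ω`, which has the parity of the dimension of `L₁ Ω / (L₁ Ω ∩ L₂)`
relative to the ground state for `L₂`. -/
def DotD.Conj (a b : DotD N) : Prop :=
  ∃ Ω ∈ orthogonal (formD N), a.g = Ω * b.g * Ω⁻¹ ∧
    b.parity = a.parity + ((Module.finrank ℂ a.L : ZMod 2)
      - (Module.finrank ℂ
          ↥(a.L.map (Matrix.vecMulLinear (Ω : Matrix (IdxD N) (IdxD N) ℂ)) ⊓ b.L) : ZMod 2))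

/-- The module `ℋ_ġ`: the subspace of fixed fermion parity. -/
def DotD.module (a : DotD N) : Submodule ℂ a.FockSpace :=
  fockParity (modeQuad (formD N) (a.g : Matrix (IdxD N) (IdxD N) ℂ))
    (annihilators (a.g : Matrix (IdxD N) (IdxD N) ℂ) a.L) a.parity

/-- `L₀` for the `g`-twisted fermions. -/
def DotD.L0 (a : DotD N) : Module.End ℂ a.FockSpace :=
  TwistFields.L0 (formD N) (a.g : Matrix (IdxD N) (IdxD N) ℂ) a.L

/-- The character `χ_ġ(q)`, `q = e^{2πiτ}`. -/
def DotD.chi (a : DotD N) (τ : ℂ) : ℂ := character a.L0 a.module τ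

end ODD

/-! ### `G = O(2N+1)` -/

section OB

variable {N : ℕ}

/-- The datum `ġ = g` for `O(2N+1)`: an element of the Cartan normalizer.  The twisted module is
presented through a polarization `L` of the zero modes. -/
structure DotB (N : ℕ) where
  g : GL (IdxB N) ℂ
  mem_orthogonal : g ∈ orthogonal (formB N)
  mem : g ∈ cartanNormalizer (cartanB N)
  L : Submodule ℂ (IdxB N → ℂ)
  pol : IsZeroModePolarization (formB N) (g : Matrix (IdxB N) (IdxB N) ℂ) L

/-- `ġ₁` and `ġ₂` are conjugate in `O(2N+1)`; the polarizations play no role. -/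
def DotB.Conj (a b : DotB N) : Prop :=
  ∃ Ω ∈ orthogonal (formB N), a.g = Ω * b.g * Ω⁻¹

/-- The module `ℋ_ġ`, which is the entire twisted Fock module. -/
abbrev DotB.Module (a : DotB N) : Type :=
  TwistedFock (formB N) (a.g : Matrix (IdxB N) (IdxB N) ℂ) a.L

/-- The vectors of `ℋ_ġ` on which `(-1)^F` is `1` (`ε = 0`) or `-1` (`ε = 1`). -/
def DotB.part (a : DotB N) (ε : ZMod 2) : Submodule ℂ a.Module :=
  fockParity (modeQuad (formB N) (a.g : Matrix (IdxB N) (IdxB N) ℂ))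
    (annihilators (a.g : Matrix (IdxB N) (IdxB N) ℂ) a.L) ε

/-- `L₀` for the `g`-twisted fermions. -/
def DotB.L0 (a : DotB N) : Module.End ℂ a.Module :=
  TwistFields.L0 (formB N) (a.g : Matrix (IdxB N) (IdxB N) ℂ) a.L

/-- The character `χ⁺(q) = tr q^{L₀}`, `q = e^{2πiτ}`. -/
def DotB.chiPlus (a : DotB N) (τ : ℂ) : ℂ := character a.L0 ⊤ τ

/-- The super-character `χ⁻(q) = tr (-1)^F q^{L₀}`, `q = e^{2πiτ}`. -/
def DotB.chiMinus (a : DotB N) (τ : ℂ) : ℂ :=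
  character a.L0 (a.part 0) τ - character a.L0 (a.part 1) τ

end OB

/-! ### Lattice theta functions -/

/-- The summand `q ^ (∑ x_i² / (2 m_i))`, `q = e^{2πiτ}`, of a theta function. -/
def gaussTerm {κ : Type} [Fintype κ] (τ : ℂ) (m : κ → ℕ) (x : κ → ℂ) : ℂ :=
  Complex.exp (2 * Real.pi * Complex.I * τ * ∑ i, x i ^ 2 / (2 * (m i : ℂ)))

/-- The sum of `q ^ (∑ (x_i + n_i)² / (2 m_i))` over the integer vectors `n` with
`∑ n_i = 0`. -/
def thetaA {κ : Type} [Fintype κ] (τ : ℂ) (m : κ → ℕ) (x : κ → ℂ) : ℂ :=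
  ∑' n : {n : κ → ℤ // ∑ i, n i = 0}, gaussTerm τ m (fun i => x i + (n.1 i : ℂ))

end TwistFields
end

/-!
**Characters.** The Fock module is spanned by ordered products of creation operators applied to
the ground state (`ι_smul_orderedState` reorders products up to shorter ones).  These vectors are
eigenvectors of `L₀`, and the creation operators can be listed with energies that lie in finitely
many arithmetic progressions, so the sum of `|q ^ L₀|` over this spanning family is bounded by the
convergent product `∏ (1 + |q ^ w|)` over the energies `w`.  An upper bound for the dimensions of
the weight spaces is enough, hence linear independence of the ordered products is never needed;
this gives characters for all `L₀`-invariant subspaces (`hasCharacter_L0`), in particular for the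
charge eigenspaces and for the two parities.

**Conjugation.** A transformation `Ω` of the fields that preserves the operator products and carries
one monodromy to the other induces an isometry of the spaces of modes and an isomorphism of Fock
modules, provided it matches the polarizations of the zero modes.  For `GL(N)` it does.  In the
orthogonal cases any two polarizations are related by a product of reflections in zero modes
(`IsZeroModePolarization.exists_twistEquiv`, Witt's theorem).  Such reflections commute with the
monodromy, so they may be absorbed into `Ω`, and the resulting isomorphism preserves parity.  It
remains to compare the two parities when the bookkeeping of `DotD.Conj` demands a change of parity:
this requires two different polarizations, hence a zero mode of non-zero square, and multiplication
by it is an isomorphism between the two parities that commutes with `L₀`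
(`character_fockParity_eq_of_ne`).

**Theta functions.** It is enough to treat one cycle of length `l` and to sum over integer vectors
of fixed total `n` (`tsum_gaussTerm_cycle`); the identity follows by multiplying over the cycles and
summing over the totals.  A cyclic shift of the coordinates that raises one of them by one shows
that these sums for different `n` are proportional to the terms `p ^ (n (n - 1) / 2)` of a single
theta series, `p = q ^ (1 / l)`.  The sum over all `n` is a product of `l` theta series of nome
`p ^ l`, which by the Jacobi triple product (`tendsto_triple_product`, from the finite `q`-binomial
theorem and dominated convergence) equals the theta series of nome `p` times a quotient of Euler
products.  Comparing the two determines the constant of proportionality (`cyclicSum_zero`).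
-/

noncomputable section

namespace TwistFields

/-! ### Traces over spaces spanned by eigenvectors -/

section Diagonalizable

variable {F : Type} [AddCommGroup F] [Module ℂ F]

/-- The eigencomponents of an element of an invariant subspace lie in the subspace. -/
lemma eigencomponent_mem_of_sum_mem {T : Module.End ℂ F} {H : Submodule ℂ F}
    (hH : ∀ x ∈ H, T x ∈ H) (s : Finset ℂ) :
    ∀ x : ℂ → F, (∀ μ ∈ s, x μ ∈ T.eigenspace μ) → ∑ μ ∈ s, x μ ∈ H → ∀ μ ∈ s, x μ ∈ H := by
  induction s using Finset.induction_on with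
  | empty => simp
  | insert ν t hν ih =>
    intro x hx hsum
    have ht : ∀ μ ∈ t, x μ ∈ H := by
      have h1 : ∑ μ ∈ t, (μ - ν) • x μ ∈ H := by
        have h2 : T (∑ μ ∈ insert ν t, x μ) - ν • ∑ μ ∈ insert ν t, x μ
            = ∑ μ ∈ t, (μ - ν) • x μ := by
          rw [map_sum, Finset.smul_sum, ← Finset.sum_sub_distrib, Finset.sum_insert hν]
          have h3 : ∀ μ ∈ insert ν t, T (x μ) - ν • x μ = (μ - ν) • x μ := fun μ hμ => by
            rw [Module.End.mem_eigenspace_iff.mp (hx μ hμ), sub_smul]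
          rw [h3 ν (Finset.mem_insert_self _ _), sub_self, zero_smul, zero_add]
          exact Finset.sum_congr rfl fun μ hμ => h3 μ (Finset.mem_insert_of_mem hμ)
        rw [← h2]
        exact sub_mem (hH _ hsum) (H.smul_mem _ hsum)
      intro μ hμ
      have h4 := ih (fun μ => (μ - ν) • x μ)
        (fun μ hμ => Submodule.smul_mem _ _ (hx μ (Finset.mem_insert_of_mem hμ))) h1 μ hμ
      have hne : μ - ν ≠ 0 := sub_ne_zero.mpr fun h => hν (h ▸ hμ)
      exact (Submodule.smul_mem_iff H hne).mp h4
    intro μ hμ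
    rcases Finset.mem_insert.mp hμ with rfl | hμ
    · rw [Finset.sum_insert hν] at hsum
      exact (Submodule.add_mem_iff_left H (Submodule.sum_mem _ ht)).mp hsum
    · exact ht μ hμ

/-- If eigenvectors span the whole space, then every invariant subspace is spanned by the
eigenvectors it contains. -/
lemma eq_iSup_weightSpace {T : Module.End ℂ F} (hT : ⨆ μ, T.eigenspace μ = ⊤)
    {H : Submodule ℂ F} (hH : ∀ x ∈ H, T x ∈ H) : H = ⨆ h : ℂ, weightSpace T H h := by
  refine le_antisymm (fun x hx => ?_) (iSup_le fun _ => inf_le_left)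
  have hx' : x ∈ ⨆ μ, T.eigenspace μ := hT ▸ Submodule.mem_top
  obtain ⟨f, hf, rfl⟩ := (Submodule.mem_iSup_iff_exists_finsupp _ _).mp hx'
  have key := eigencomponent_mem_of_sum_mem hH f.support f (fun μ _ => hf μ) hx
  exact Submodule.sum_mem _ fun μ hμ => Submodule.mem_iSup_of_mem μ ⟨key μ hμ, hf μ⟩

variable {J : Type} {T : Module.End ℂ F} {e : J → F} {w : J → ℂ}

/-- If eigenvectors `e j` of weights `w j` span the whole space, then the eigenspace of weight `h`
is spanned by those `e j` with `w j = h`. -/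
lemma eigenspace_le_span (he : ∀ j, T (e j) = w j • e j)
    (hspan : ⊤ ≤ Submodule.span ℂ (Set.range e)) (h : ℂ) :
    T.eigenspace h ≤ Submodule.span ℂ (Set.range fun j : {j // w j = h} => e j) := by
  intro x hx
  set E : ℂ → Submodule ℂ F := fun μ =>
    Submodule.span ℂ (Set.range fun j : {j // w j = μ} => e j) with hE
  have hEle : ∀ μ, E μ ≤ T.eigenspace μ := fun μ => by
    rw [hE, Submodule.span_le]
    rintro _ ⟨⟨j, rfl⟩, rfl⟩
    exact Module.End.mem_eigenspace_iff.mpr (he j)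
  have htop : x ∈ E h ⊔ ⨆ μ, ⨆ _ : μ ≠ h, T.eigenspace μ := by
    have : Submodule.span ℂ (Set.range e) ≤ E h ⊔ ⨆ μ, ⨆ _ : μ ≠ h, T.eigenspace μ := by
      rw [Submodule.span_le]
      rintro _ ⟨j, rfl⟩
      by_cases hj : w j = h
      · exact Submodule.mem_sup_left (Submodule.subset_span ⟨⟨j, hj⟩, rfl⟩)
      · refine Submodule.mem_sup_right (Submodule.mem_iSup_of_mem (w j) ?_)
        exact Submodule.mem_iSup_of_mem hj (Module.End.mem_eigenspace_iff.mpr (he j))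
    exact this (hspan Submodule.mem_top)
  obtain ⟨y, hy, z, hz, rfl⟩ := Submodule.mem_sup.mp htop
  have hz' : z ∈ T.eigenspace h := by
    have := sub_mem hx (hEle h hy)
    rwa [add_sub_cancel_left] at this
  have hdis := T.eigenspaces_iSupIndep h
  have hz0 : z = 0 := by
    have := Submodule.disjoint_def.mp hdis z hz' hz
    exact this
  rwa [hz0, add_zero]

/-- A spanning family of eigenvectors over which `q ^ T` is absolutely summable bounds the
characters of all invariant subspaces. -/
lemma HasCharacter.of_spanning (he : ∀ j, T (e j) = w j • e j)
    (hspan : ⊤ ≤ Submodule.span ℂ (Set.range e))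
    (hsum : ∀ τ : ℂ, 0 < τ.im →
      Summable fun j => ‖Complex.exp (2 * Real.pi * Complex.I * τ * w j)‖)
    {H : Submodule ℂ F} (hH : ∀ x ∈ H, T x ∈ H) : HasCharacter T H := by
  have hfin : ∀ h : ℂ, Finite {j // w j = h} := by
    intro h
    have h1 := (hsum Complex.I (by simp)).tendsto_cofinite_zero
    have h2 : 0 < ‖Complex.exp (2 * Real.pi * Complex.I * Complex.I * h)‖ := by
      simp [Complex.exp_ne_zero]
    have h3 := h1.eventually_lt_const h2
    rw [Filter.eventually_cofinite] at h3
    refine (h3.subset ?_).to_subtype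
    rintro j rfl
    simp
  have hle : ∀ h : ℂ, weightSpace T H h ≤
      Submodule.span ℂ (Set.range fun j : {j // w j = h} => e j) := fun h =>
    inf_le_right.trans (eigenspace_le_span he hspan h)
  have hfd : ∀ h : ℂ, FiniteDimensional ℂ
      (Submodule.span ℂ (Set.range fun j : {j // w j = h} => e j)) := fun h => by
    have := hfin h
    exact FiniteDimensional.span_of_finite ℂ (Set.finite_range _)
  refine ⟨eq_iSup_weightSpace ?_ hH, fun h => ?_, fun τ hτ => ?_⟩
  · rw [← top_le_iff]
    refine hspan.trans (Submodule.span_le.mpr ?_)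
    rintro _ ⟨j, rfl⟩
    exact Submodule.mem_iSup_of_mem (w j) (Module.End.mem_eigenspace_iff.mpr (he j))
  · have := hfd h
    exact Submodule.finiteDimensional_of_le (hle h)
  · have h1 := ((Equiv.sigmaFiberEquiv w).summable_iff).mpr (hsum τ hτ)
    refine Summable.of_norm_bounded h1.sigma fun h => ?_
    have := hfin h
    have := hfd h
    have hcard : Module.finrank ℂ (weightSpace T H h) ≤ Nat.card {j // w j = h} := by
      have := Fintype.ofFinite {j // w j = h}
      rw [Nat.card_eq_fintype_card]
      exact (Submodule.finrank_mono (hle h)).trans (finrank_range_le_card _)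
    have h2 : ∑' c : {j // w j = h}, ((fun j => ‖Complex.exp (2 * Real.pi * Complex.I * τ * w j)‖)
        ∘ (Equiv.sigmaFiberEquiv w)) ⟨h, c⟩
        = Nat.card {j // w j = h} * ‖Complex.exp (2 * Real.pi * Complex.I * τ * h)‖ := by
      rw [← nsmul_eq_mul, ← tsum_const]
      exact tsum_congr fun c => by simp [c.2]
    rw [h2, norm_mul, Complex.norm_natCast]
    gcongr

/-- Characters are invariant under isomorphisms that intertwine the operators. -/
lemma character_congr {F' : Type} [AddCommGroup F'] [Module ℂ F'] {T' : Module.End ℂ F'}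
    (Φ : F ≃ₗ[ℂ] F') (hΦ : ∀ x, Φ (T x) = T' (Φ x)) {H : Submodule ℂ F} {H' : Submodule ℂ F'}
    (hH : ∀ x, x ∈ H ↔ Φ x ∈ H') (τ : ℂ) : character T H τ = character T' H' τ := by
  unfold character
  congr! 4 with h
  have : (weightSpace T H h).map Φ.toLinearMap = weightSpace T' H' h := by
    ext y
    obtain ⟨x, rfl⟩ := Φ.surjective y
    simp only [weightSpace, Submodule.mem_map, Submodule.mem_inf, Module.End.mem_eigenspace_iff,
      LinearEquiv.coe_coe, ← hΦ, ← map_smul, ← hH, Φ.injective.eq_iff, exists_eq_right]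
  rw [← this]
  exact (LinearEquiv.finrank_map_eq Φ _).symm

end Diagonalizable

/-! ### Ordered states in Fock modules -/

section OrderedStates

set_option linter.unusedSectionVars false

variable {M : Type} [AddCommGroup M] [Module ℂ M] {Q : QuadraticForm ℂ M}
  {F : Type} [AddCommGroup F] [Module ℂ F] [Module (CliffordAlgebra Q) F]
  [IsScalarTower ℂ (CliffordAlgebra Q) F]

lemma ι_smul_ι_smul (f g : M) (x : F) :
    CliffordAlgebra.ι Q f • CliffordAlgebra.ι Q g • x
      = QuadraticMap.polar Q f g • x - CliffordAlgebra.ι Q g • CliffordAlgebra.ι Q f • x := by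
  rw [eq_sub_iff_add_eq, smul_smul, smul_smul, ← add_smul, CliffordAlgebra.ι_mul_ι_add_swap,
    algebraMap_smul]

lemma ι_smul_ι_smul_self (f : M) (x : F) :
    CliffordAlgebra.ι Q f • CliffordAlgebra.ι Q f • x = Q f • x := by
  rw [smul_smul, CliffordAlgebra.ι_sq_scalar, algebraMap_smul]

variable {I : Type} [LinearOrder I] (b : I → M) (v : F)

variable (Q) in
/-- The vector obtained from `v` by the generators `b i`, `i ∈ s`, applied in the
order of the labels, the largest label first. -/
def orderedState (s : Finset I) : F :=
  ((s.sort (· ≤ ·)).map fun i => CliffordAlgebra.ι Q (b i)).prod • v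

lemma orderedState_empty : orderedState Q b v ∅ = v := by
  simp [orderedState]

variable {b v} in
lemma orderedState_insert {a : I} {s : Finset I} (h : ∀ x ∈ s, a < x) :
    orderedState Q b v (insert a s) = CliffordAlgebra.ι Q (b a) • orderedState Q b v s := by
  rw [orderedState, Finset.sort_insert (· ≤ ·) (fun x hx => (h x hx).le) fun hx => (h a hx).false,
    List.map_cons, List.prod_cons, mul_smul, orderedState]

variable (Q) in
/-- The span of the ordered states with fewer than `n` generators. -/
def stateFiltration (n : ℕ) : Submodule ℂ F :=
  Submodule.span ℂ (orderedState Q b v '' {s | s.card < n})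

variable {b v} in
lemma orderedState_mem_filtration {s : Finset I} {n : ℕ} (h : s.card < n) :
    orderedState Q b v s ∈ stateFiltration Q b v n :=
  Submodule.subset_span ⟨s, h, rfl⟩

lemma stateFiltration_mono {m n : ℕ} (h : m ≤ n) :
    stateFiltration Q b v m ≤ stateFiltration Q b v n :=
  Submodule.span_mono (Set.image_mono fun _ hs => lt_of_lt_of_le hs h)

/-- Reordering: up to states with fewer generators, an annihilation operator kills an ordered
state and a generator `b c` inserts `c`, with some coefficient. -/
lemma ι_smul_orderedState {P : Submodule ℂ M} (hP : ∀ p ∈ P, CliffordAlgebra.ι Q p • v = 0)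
    (n : ℕ) : ∀ s : Finset I, s.card = n →
    (∀ p ∈ P, CliffordAlgebra.ι Q p • orderedState Q b v s ∈ stateFiltration Q b v n) ∧
    ∀ c, ∃ ε : ℂ, CliffordAlgebra.ι Q (b c) • orderedState Q b v s
      - ε • orderedState Q b v (insert c s) ∈ stateFiltration Q b v n := by
  induction n using Nat.strong_induction_on with
  | _ n ih =>
  -- the induction hypothesis, extended to linear combinations of shorter states
  have hb : ∀ c k, k ≤ n → ∀ x ∈ stateFiltration Q b v k,
      CliffordAlgebra.ι Q (b c) • x ∈ stateFiltration Q b v (k + 1) := by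
    intro c k hk x hx
    induction hx using Submodule.span_induction with
    | mem x hx =>
      obtain ⟨t, ht, rfl⟩ := hx
      have ht : t.card < k := ht
      obtain ⟨ε, hε⟩ := (ih t.card (ht.trans_le hk) t rfl).2 c
      have h1 := add_mem (stateFiltration_mono b v (show t.card ≤ k + 1 by omega) hε)
        (Submodule.smul_mem _ ε (orderedState_mem_filtration (Q := Q) (b := b) (v := v)
          (show (insert c t).card < k + 1 by have := Finset.card_insert_le c t; omega)))
      rwa [sub_add_cancel] at h1
    | zero => rw [smul_zero]; exact zero_mem _
    | add x y _ _ hx hy => rw [smul_add]; exact add_mem hx hy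
    | smul r x _ hx => rw [smul_comm]; exact Submodule.smul_mem _ _ hx
  intro s hs
  induction s using Finset.induction_on_min with
  | empty =>
    rw [orderedState_empty]
    refine ⟨fun p hp => ?_, fun c => ⟨1, ?_⟩⟩
    · rw [hP p hp]; exact zero_mem _
    · rw [orderedState_insert (by simp), orderedState_empty, one_smul, sub_self]
      exact zero_mem _
  | insert a s has _ =>
    have ha : a ∉ s := fun h => (has a h).false
    rw [Finset.card_insert_of_notMem ha] at hs
    obtain ⟨ihP, ihb⟩ := ih s.card (by omega) s rfl
    have hmem : orderedState Q b v s ∈ stateFiltration Q b v n :=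
      orderedState_mem_filtration (by omega)
    rw [orderedState_insert has]
    refine ⟨fun p hp => ?_, fun c => ?_⟩
    · rw [ι_smul_ι_smul]
      refine sub_mem (Submodule.smul_mem _ _ hmem) ?_
      have := hb a s.card (by omega) _ (ihP p hp)
      rwa [hs] at this
    · rcases lt_trichotomy c a with hca | rfl | hac
      · refine ⟨1, ?_⟩
        rw [orderedState_insert (a := c), orderedState_insert has, one_smul, sub_self]
        · exact zero_mem _
        · intro x hx
          rcases Finset.mem_insert.mp hx with rfl | hx
          exacts [hca, hca.trans (has x hx)]
      · refine ⟨0, ?_⟩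
        rw [zero_smul, sub_zero, ι_smul_ι_smul_self]
        exact Submodule.smul_mem _ _ hmem
      · obtain ⟨ε, hε⟩ := ihb c
        refine ⟨-ε, ?_⟩
        have h2 := hb a s.card (by omega) _ hε
        rw [hs, smul_sub, smul_comm _ ε] at h2
        have has' : ∀ x ∈ insert c s, a < x := by
          intro x hx
          rcases Finset.mem_insert.mp hx with rfl | hx
          exacts [hac, has x hx]
        rw [Finset.insert_comm, orderedState_insert has', ι_smul_ι_smul, neg_smul]
        have h3 := sub_mem (Submodule.smul_mem _ (QuadraticMap.polar Q (b c) (b a)) hmem) h2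
        convert h3 using 1
        abel

/-- If the generators `b i` and the annihilation operators together span the space of generators
of the Clifford algebra, then the ordered states built on a vector `v` killed by the annihilation
operators span the Clifford submodule generated by `v`. -/
lemma smul_mem_span_orderedState {P : Submodule ℂ M}
    (hP : ∀ p ∈ P, CliffordAlgebra.ι Q p • v = 0) (h : ⊤ ≤ P ⊔ Submodule.span ℂ (Set.range b))
    (y : CliffordAlgebra Q) : y • v ∈ Submodule.span ℂ (Set.range (orderedState Q b v)) := by
  set W := Submodule.span ℂ (Set.range (orderedState Q b v)) with hW
  have hFW : ∀ n, stateFiltration Q b v n ≤ W := fun n =>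
    Submodule.span_mono (Set.image_subset_range _ _)
  have hPs : ∀ p ∈ P, ∀ x ∈ W, CliffordAlgebra.ι Q p • x ∈ W := by
    intro p hp x hx
    induction hx using Submodule.span_induction with
    | mem x hx =>
      obtain ⟨t, rfl⟩ := hx
      exact hFW _ ((ι_smul_orderedState b v hP t.card t rfl).1 p hp)
    | zero => rw [smul_zero]; exact zero_mem _
    | add x y _ _ hx hy => rw [smul_add]; exact add_mem hx hy
    | smul r x _ hx => rw [smul_comm]; exact Submodule.smul_mem _ _ hx
  have hbs : ∀ c, ∀ x ∈ W, CliffordAlgebra.ι Q (b c) • x ∈ W := by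
    intro c x hx
    induction hx using Submodule.span_induction with
    | mem x hx =>
      obtain ⟨t, rfl⟩ := hx
      obtain ⟨ε, hε⟩ := (ι_smul_orderedState b v hP t.card t rfl).2 c
      have h1 := add_mem (hFW _ hε) (W.smul_mem ε (Submodule.subset_span ⟨insert c t, rfl⟩))
      rwa [sub_add_cancel] at h1
    | zero => rw [smul_zero]; exact zero_mem _
    | add x y _ _ hx hy => rw [smul_add]; exact add_mem hx hy
    | smul r x _ hx => rw [smul_comm]; exact Submodule.smul_mem _ _ hx
  have hs : ∀ f, ∀ x ∈ W, CliffordAlgebra.ι Q f • x ∈ W := by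
    intro f x hx
    obtain ⟨p, hp, g, hg, rfl⟩ := Submodule.mem_sup.mp (h (Submodule.mem_top (x := f)))
    rw [map_add, add_smul]
    refine add_mem (hPs p hp x hx) ?_
    induction hg using Submodule.span_induction with
    | mem g hg => obtain ⟨c, rfl⟩ := hg; exact hbs c x hx
    | zero => rw [map_zero, zero_smul]; exact zero_mem _
    | add g g' _ _ hg hg' => rw [map_add, add_smul]; exact add_mem hg hg'
    | smul r g _ hg => rw [map_smul, smul_assoc]; exact Submodule.smul_mem _ _ hg
  revert y
  have hall : ∀ y : CliffordAlgebra Q, ∀ x ∈ W, y • x ∈ W := by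
    intro y
    induction y using CliffordAlgebra.induction with
    | algebraMap r => intro x hx; rw [algebraMap_smul]; exact W.smul_mem _ hx
    | ι f => exact hs f
    | mul y z hy hz => intro x hx; rw [mul_smul]; exact hy _ (hz _ hx)
    | add y z hy hz => intro x hx; rw [add_smul]; exact add_mem (hy _ hx) (hz _ hx)
  exact fun y => hall y v (Submodule.subset_span ⟨∅, orderedState_empty b v⟩)

/-- An operator that acts on the generators by a derivation with `b i ↦ w i • b i` is diagonal
on the ordered states. -/
lemma apply_orderedState {T : Module.End ℂ F} {A : Module.End ℂ M} {c : ℂ}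
    (hT : ∀ f x, T (CliffordAlgebra.ι Q f • x)
      = CliffordAlgebra.ι Q f • T x + CliffordAlgebra.ι Q (A f) • x) (hv : T v = c • v)
    {w : I → ℂ} (hw : ∀ i, A (b i) = w i • b i) (s : Finset I) :
    T (orderedState Q b v s) = (∑ i ∈ s, w i + c) • orderedState Q b v s := by
  induction s using Finset.induction_on_min with
  | empty => rw [orderedState_empty, hv, Finset.sum_empty, zero_add]
  | insert a s has ih =>
    have ha : a ∉ s := fun h => (has a h).false
    rw [orderedState_insert has, hT, ih, hw, Finset.sum_insert ha, map_smul,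
      smul_assoc, smul_comm, ← add_smul, add_comm, add_assoc]

variable (P : Submodule ℂ M)

lemma ι_smul_ground {f : M} (hf : f ∈ P) : CliffordAlgebra.ι Q f • fockMk Q P 1 = 0 := by
  change fockMk Q P (CliffordAlgebra.ι Q f * 1) = 0
  rw [mul_one]
  exact (Submodule.Quotient.mk_eq_zero _).mpr (Submodule.subset_span ⟨f, hf, rfl⟩)

lemma smul_ground (y : CliffordAlgebra Q) : y • fockMk Q P 1 = fockMk Q P y := by
  change fockMk Q P (y * 1) = _
  rw [mul_one]

variable {P} in
lemma top_le_span_fockState (h : ⊤ ≤ P ⊔ Submodule.span ℂ (Set.range b)) :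
    ⊤ ≤ Submodule.span ℂ (Set.range (orderedState Q b (fockMk Q P 1))) := by
  intro x _
  obtain ⟨y, rfl⟩ := (vacIdeal Q P).mkQ_surjective x
  have h2 := smul_mem_span_orderedState b (fockMk Q P 1) (fun p hp => ι_smul_ground P hp) h y
  rwa [smul_ground] at h2

end OrderedStates

/-! ### Operators on Fock modules -/

section Operators

variable {M : Type} [AddCommGroup M] [Module ℂ M]

/-- Two operators on the Fock module that act on the generators by commuting maps and have the
ground state as an eigenvector commute. -/
lemma fock_operators_commute {Q : QuadraticForm ℂ M} {P : Submodule ℂ M}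
    {T T' : Module.End ℂ (Fock Q P)} {A A' : Module.End ℂ M} {c c' : ℂ}
    (hT : ∀ f x, T (CliffordAlgebra.ι Q f • x)
      = CliffordAlgebra.ι Q f • T x + CliffordAlgebra.ι Q (A f) • x)
    (hT' : ∀ f x, T' (CliffordAlgebra.ι Q f • x)
      = CliffordAlgebra.ι Q f • T' x + CliffordAlgebra.ι Q (A' f) • x)
    (hc : T (fockMk Q P 1) = c • fockMk Q P 1) (hc' : T' (fockMk Q P 1) = c' • fockMk Q P 1)
    (hA : ∀ f, A (A' f) = A' (A f)) (x : Fock Q P) : T (T' x) = T' (T x) := by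
  have key : ∀ y : CliffordAlgebra Q, ∀ x, T (T' x) = T' (T x) →
      T (T' (y • x)) = T' (T (y • x)) := by
    intro y
    induction y using CliffordAlgebra.induction with
    | algebraMap r =>
      intro x hx
      rw [algebraMap_smul, map_smul, map_smul, hx, map_smul, map_smul]
    | ι f =>
      intro x hx
      rw [hT, hT', map_add, map_add, hT, hT, hT', hT', hx, hA]
      abel
    | mul y z hy hz => intro x hx; rw [mul_smul]; exact hy _ (hz _ hx)
    | add y z hy hz =>
      intro x hx
      rw [add_smul, map_add, map_add, map_add, map_add, hy _ hx, hz _ hx]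
  obtain ⟨y, rfl⟩ := (vacIdeal Q P).mkQ_surjective x
  have h := key y (fockMk Q P 1) (by rw [hc, hc', map_smul, map_smul, hc, hc', smul_comm])
  rwa [smul_ground] at h

lemma cliffordDer_mem_evenOdd {Q : QuadraticForm ℂ M} {A : Module.End ℂ M} (hA : IsSkew Q A)
    (ε : ZMod 2) {y : CliffordAlgebra Q} (hy : y ∈ CliffordAlgebra.evenOdd Q ε) :
    cliffordDer Q A hA y ∈ CliffordAlgebra.evenOdd Q ε := by
  have hι : ∀ f, CliffordAlgebra.ι Q f ∈ CliffordAlgebra.evenOdd Q 1 :=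
    CliffordAlgebra.ι_mem_evenOdd_one Q
  have h1 : cliffordDer Q A hA 1 = 0 := by simp [cliffordDer]
  have hstep : ∀ m₁ m₂ : M, ∀ x ∈ CliffordAlgebra.evenOdd Q ε,
      cliffordDer Q A hA x ∈ CliffordAlgebra.evenOdd Q ε →
      cliffordDer Q A hA (CliffordAlgebra.ι Q m₁ * CliffordAlgebra.ι Q m₂ * x)
        ∈ CliffordAlgebra.evenOdd Q ε := by
    intro m₁ m₂ x hx ih
    have h2 : ∀ f g, ∀ z ∈ CliffordAlgebra.evenOdd Q ε,
        CliffordAlgebra.ι Q f * CliffordAlgebra.ι Q g * z ∈ CliffordAlgebra.evenOdd Q ε := by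
      intro f g z hz
      have h3 := SetLike.mul_mem_graded (SetLike.mul_mem_graded (hι f) (hι g)) hz
      rwa [show (1 : ZMod 2) + 1 = 0 from rfl, zero_add] at h3
    rw [cliffordDer_mul, cliffordDer_mul, cliffordDer_ι, cliffordDer_ι, add_mul]
    exact add_mem (h2 _ _ _ ih) (add_mem (h2 _ _ _ hx) (h2 _ _ _ hx))
  induction y, hy using CliffordAlgebra.evenOdd_induction with
  | range_ι_pow v h =>
    fin_cases ε
    · obtain ⟨r, rfl⟩ := Submodule.mem_one.mp h
      rw [Algebra.algebraMap_eq_smul_one, map_smul, h1, smul_zero]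
      exact zero_mem _
    · obtain ⟨f, rfl⟩ := (pow_one (LinearMap.range (CliffordAlgebra.ι Q))) ▸ h
      rw [cliffordDer_ι]
      exact hι _
  | add x y _ _ hx hy => rw [map_add]; exact add_mem hx hy
  | ι_mul_ι_mul m₁ m₂ x hx ih => exact hstep m₁ m₂ x hx ih

lemma secondQuant_mem_fockParity {Q : QuadraticForm ℂ M} {P : Submodule ℂ M} {A : Module.End ℂ M}
    (hA : IsSkew Q A) (hP : ∀ f ∈ P, A f ∈ P) (ε : ZMod 2) {x : Fock Q P}
    (hx : x ∈ fockParity Q P ε) : secondQuant Q P A hA hP x ∈ fockParity Q P ε := by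
  obtain ⟨y, hy, rfl⟩ := hx
  exact ⟨cliffordDer Q A hA y, cliffordDer_mem_evenOdd hA ε hy, rfl⟩

end Operators

/-! ### Characters of twisted Fock modules -/

section Modes

variable {ι : Type} [Fintype ι]

/-- The mode `Φ_{v,p}` of a field whose monodromy admits the index `p`. -/
def modeSingle (D : Matrix ι ι ℂ) (p : ℂ) :
    Module.End.eigenspace (Matrix.vecMulLinear D)
      (-Complex.exp (-(2 * Real.pi * Complex.I * p))) →ₗ[ℂ] Mode D where
  toFun v := ⟨Finsupp.single p v.1, fun p' => by
    classical
    rw [Finsupp.single_apply]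
    split_ifs with h
    · subst h; exact Module.End.mem_eigenspace_iff.mp v.2
    · simp⟩
  map_add' v w := Subtype.ext (Finsupp.single_add _ _ _)
  map_smul' c v := Subtype.ext (Finsupp.smul_single _ _ _).symm

/-- The underlying family of coefficient vectors, as a linear map. -/
def modeVal (D : Matrix ι ι ℂ) : Mode D →ₗ[ℂ] (ℂ →₀ (ι → ℂ)) := (modeSpace D).subtype

lemma mode_eq_sum_single {D : Matrix ι ι ℂ} (f : Mode D) :
    f = ∑ p ∈ f.1.support, modeSingle D p ⟨f.1 p, Module.End.mem_eigenspace_iff.mpr (f.2 p)⟩ := by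
  apply (modeSpace D).injective_subtype
  change modeVal D f = modeVal D _
  rw [map_sum]
  exact f.1.sum_single.symm

lemma energyMap_modeSingle (D : Matrix ι ι ℂ) (p : ℂ) (v) :
    energyMap D (modeSingle D p v) = (-p) • modeSingle D p v := by
  refine Mode.ext' fun p' => ?_
  change (-p') • (Finsupp.single p v.1 : ℂ →₀ (ι → ℂ)) p' = (-p) • (Finsupp.single p v.1 : _) p'
  classical
  rw [Finsupp.single_apply]
  split_ifs with h
  · subst h; rfl
  · simp

/-- The non-zero eigenvalues of the monodromy (acting on row vectors). -/
abbrev Monodromy (D : Matrix ι ι ℂ) : Type :=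
  {μ : ℂ // μ ≠ 0 ∧ Module.End.HasEigenvalue (Matrix.vecMulLinear D) μ}

instance (D : Matrix ι ι ℂ) : Finite (Monodromy D) :=
  ((Module.End.finite_hasEigenvalue (Matrix.vecMulLinear D)).subset fun _ h => h.2).to_subtype

/-- Labels of a family of modes that, together with the annihilation operators, spans all modes:
an eigenvalue of the monodromy, the number of a basis vector of its eigenspace, and a natural
number that lowers the mode index. -/
abbrev ModeLabel (D : Matrix ι ι ℂ) : Type :=
  (Σ μ : Monodromy D, Fin (Module.finrank ℂ
    (Module.End.eigenspace (Matrix.vecMulLinear D) μ.1))) × ℕ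

/-- The mode index belonging to a label.  For each eigenvalue these are the admissible indices of
real part less than `3/2`; that some of them are positive does no harm in a spanning family. -/
def labelIndex {D : Matrix ι ι ℂ} (i : ModeLabel D) : ℂ :=
  Complex.log (-i.1.1.1) / (-(2 * Real.pi * Complex.I)) + 1 - i.2

lemma neg_exp_labelIndex {D : Matrix ι ι ℂ} (i : ModeLabel D) :
    -Complex.exp (-(2 * Real.pi * Complex.I * labelIndex i)) = i.1.1.1 := by
  have hπ := Complex.two_pi_I_ne_zero
  have h : -(2 * Real.pi * Complex.I * labelIndex i)
      = Complex.log (-i.1.1.1) + ((i.2 : ℤ) - 1 : ℤ) * (2 * Real.pi * Complex.I) := by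
    rw [labelIndex]
    field_simp
    push_cast
    ring
  rw [h, Complex.exp_add, Complex.exp_int_mul_two_pi_mul_I, mul_one,
    Complex.exp_log (neg_ne_zero.mpr i.1.1.2.1), neg_neg]

/-- The mode with a given label. -/
def labelMode {D : Matrix ι ι ℂ} (i : ModeLabel D) : Mode D :=
  modeSingle D (labelIndex i) ⟨(Module.finBasis ℂ
    (Module.End.eigenspace (Matrix.vecMulLinear D) i.1.1.1) i.1.2 : ι → ℂ), by
      rw [neg_exp_labelIndex]; exact Subtype.property _⟩

lemma energyMap_labelMode {D : Matrix ι ι ℂ} (i : ModeLabel D) :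
    energyMap D (labelMode i) = (-labelIndex i) • labelMode i :=
  energyMap_modeSingle _ _ _

/-- Every admissible index that is not positive belongs to some label. -/
lemma exists_labelIndex_eq {D : Matrix ι ι ℂ} {p : ℂ} (hp : ¬ ModePos p) {μ : Monodromy D}
    (hμ : -Complex.exp (-(2 * Real.pi * Complex.I * p)) = μ.1) :
    ∃ n : ℕ, p = Complex.log (-μ.1) / (-(2 * Real.pi * Complex.I)) + 1 - n := by
  have hre : p.re ≤ 0 := by
    by_contra! h
    exact hp (Or.inl h)
  have h1 : Complex.exp (-(2 * Real.pi * Complex.I * p)) = Complex.exp (Complex.log (-μ.1)) := by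
    rw [Complex.exp_log (neg_ne_zero.mpr μ.2.1), ← hμ, neg_neg]
  obtain ⟨k, hk⟩ := Complex.exp_eq_exp_iff_exists_int.mp h1
  have hπ := Complex.two_pi_I_ne_zero
  have him := congrArg Complex.im hk
  simp only [Complex.neg_im, Complex.add_im, Complex.mul_im, Complex.mul_re, Complex.log_im,
    Complex.I_re, Complex.I_im, Complex.ofReal_re, Complex.ofReal_im, Complex.intCast_re,
    Complex.intCast_im, Complex.re_ofNat, Complex.im_ofNat] at him
  have harg := Complex.neg_pi_lt_arg (-μ.1)
  have harg' := Complex.arg_le_pi (-μ.1)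
  have hk' : -1 ≤ k := by
    have : (-1 : ℝ) < (k : ℝ) + 1 := by
      by_contra! hcon
      nlinarith [Real.pi_pos]
    have : (-1 : ℤ) < k + 1 := by exact_mod_cast this
    omega
  refine ⟨(k + 1).toNat, ?_⟩
  have hn : (((k + 1).toNat : ℕ) : ℂ) = k + 1 := by
    have : (((k + 1).toNat : ℤ) : ℂ) = ((k + 1 : ℤ) : ℂ) := by rw [Int.toNat_of_nonneg (by omega)]
    push_cast at this
    exact this
  rw [hn]
  have h2 : p = (Complex.log (-μ.1) + k * (2 * Real.pi * Complex.I))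
      / (-(2 * Real.pi * Complex.I)) := by
    rw [← hk]
    field_simp
  rw [h2]
  field_simp
  ring

/-- The annihilation operators and the labelled modes span all modes. -/
lemma top_le_annihilators_sup_span (D : Matrix ι ι ℂ) (L : Submodule ℂ (ι → ℂ)) :
    ⊤ ≤ annihilators D L ⊔ Submodule.span ℂ (Set.range (labelMode (D := D))) := by
  intro f _
  rw [mode_eq_sum_single f]
  refine Submodule.sum_mem _ fun p _ => ?_
  generalize (⟨f.1 p, Module.End.mem_eigenspace_iff.mpr (f.2 p)⟩ :
    Module.End.eigenspace (Matrix.vecMulLinear D)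
      (-Complex.exp (-(2 * Real.pi * Complex.I * p)))) = v
  by_cases hp : ModePos p
  · refine Submodule.mem_sup_left ?_
    have hp0 : p ≠ 0 := by rintro rfl; simp [ModePos] at hp
    refine ⟨?_, fun p' _ hp' => ?_⟩
    · change (Finsupp.single p v.1 : ℂ →₀ (ι → ℂ)) 0 ∈ L
      rw [Finsupp.single_eq_of_ne hp0.symm]
      exact zero_mem _
    · exact Finsupp.single_eq_of_ne fun h => hp' (h ▸ hp)
  · refine Submodule.mem_sup_right ?_
    by_cases hv : v = 0
    · rw [hv, map_zero]; exact zero_mem _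
    let μ : Monodromy D := ⟨-Complex.exp (-(2 * Real.pi * Complex.I * p)),
      neg_ne_zero.mpr (Complex.exp_ne_zero _),
      Module.End.hasEigenvalue_of_hasEigenvector ⟨v.2, fun h => hv (Subtype.ext h)⟩⟩
    obtain ⟨n, hn⟩ := exists_labelIndex_eq hp (μ := μ) rfl
    have hv' := (Module.finBasis ℂ (Module.End.eigenspace (Matrix.vecMulLinear D) μ.1)).sum_repr v
    rw [← hv', map_sum]
    refine Submodule.sum_mem _ fun j _ => ?_
    rw [map_smul]
    refine Submodule.smul_mem _ _ (Submodule.subset_span ⟨(⟨μ, j⟩, n), ?_⟩)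
    apply Subtype.ext
    change Finsupp.single (labelIndex _) _ = Finsupp.single p _
    exact congrArg (fun p => (Finsupp.single p _ : ℂ →₀ (ι → ℂ))) hn.symm

lemma summable_labelIndex (D : Matrix ι ι ℂ) {τ : ℂ} (hτ : 0 < τ.im) :
    Summable fun i : ModeLabel D =>
      ‖Complex.exp (2 * Real.pi * Complex.I * τ * (-labelIndex i))‖ := by
  rw [summable_prod_of_nonneg fun _ => norm_nonneg _]
  refine ⟨fun j => ?_, Summable.of_finite⟩
  have hq : ‖Complex.exp (2 * Real.pi * Complex.I * τ)‖ < 1 := by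
    rw [Complex.norm_exp, Real.exp_lt_one_iff]
    simp only [Complex.mul_re, Complex.mul_im, Complex.I_re, Complex.I_im, Complex.ofReal_re,
      Complex.ofReal_im, Complex.re_ofNat, Complex.im_ofNat]
    nlinarith [Real.pi_pos, mul_pos Real.pi_pos hτ]
  have h := (summable_geometric_of_lt_one (norm_nonneg _) hq).mul_left
    ‖Complex.exp (2 * Real.pi * Complex.I * τ *
      (-(Complex.log (-j.1.1) / (-(2 * Real.pi * Complex.I)) + 1)))‖
  refine h.congr fun n => ?_
  rw [← norm_pow, ← Complex.exp_nat_mul, ← norm_mul, ← Complex.exp_add]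
  congr 2
  simp only [labelIndex]
  ring

variable [DecidableEq ι] {S D : Matrix ι ι ℂ} {L : Submodule ℂ (ι → ℂ)}

lemma L0_smul (f : Mode D) (x : TwistedFock S D L) :
    L0 S D L (CliffordAlgebra.ι (modeQuad S D) f • x)
      = CliffordAlgebra.ι (modeQuad S D) f • L0 S D L x
        + CliffordAlgebra.ι (modeQuad S D) (energyMap D f) • x := by
  rw [L0, LinearMap.add_apply, LinearMap.add_apply, secondQuant_smul, smul_add,
    LinearMap.smul_apply, LinearMap.smul_apply, LinearMap.id_apply, LinearMap.id_apply]
  rw [smul_comm (groundWeight D)]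
  abel

lemma L0_ground : L0 S D L (fockMk (modeQuad S D) (annihilators D L) 1)
    = groundWeight D • fockMk (modeQuad S D) (annihilators D L) 1 := by
  rw [L0, LinearMap.add_apply, secondQuant_ground, zero_add]
  rfl

/-- Every `L₀`-invariant subspace of a twisted Fock module has a character. -/
lemma hasCharacter_L0 {H : Submodule ℂ (TwistedFock S D L)} (hH : ∀ x ∈ H, L0 S D L x ∈ H) :
    HasCharacter (L0 S D L) H := by
  classical
  let _ : LinearOrder (ModeLabel D) := IsWellOrder.linearOrder WellOrderingRel
  refine HasCharacter.of_spanning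
    (w := fun s : Finset (ModeLabel D) => ∑ i ∈ s, -labelIndex i + groundWeight D)
    (apply_orderedState labelMode _ L0_smul L0_ground energyMap_labelMode)
    (top_le_span_fockState labelMode (top_le_annihilators_sup_span D L)) (fun τ hτ => ?_) hH
  have h := (summable_finsetProd_of_summable_nonneg (fun _ => norm_nonneg _)
    (summable_labelIndex D hτ)).mul_right
      ‖Complex.exp (2 * Real.pi * Complex.I * τ * groundWeight D)‖
  refine h.congr fun s => ?_
  rw [← norm_prod, ← Complex.exp_sum, ← norm_mul, ← Complex.exp_add, mul_add, Finset.mul_sum]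

lemma L0_mem_fockParity (ε : ZMod 2) {x : TwistedFock S D L}
    (hx : x ∈ fockParity (modeQuad S D) (annihilators D L) ε) :
    L0 S D L x ∈ fockParity (modeQuad S D) (annihilators D L) ε := by
  rw [L0, LinearMap.add_apply]
  exact add_mem (secondQuant_mem_fockParity _ _ ε hx) (Submodule.smul_mem _ _ hx)

lemma J0_smul {N : ℕ} (g : GL (Fin N) ℂ) (f : Mode (monodromyGL g)) (x : FockGL g) :
    J0 g (CliffordAlgebra.ι (modeQuad (formD N) (monodromyGL g)) f • x)
      = CliffordAlgebra.ι (modeQuad (formD N) (monodromyGL g)) f • J0 g x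
        + CliffordAlgebra.ι (modeQuad (formD N) (monodromyGL g)) (chargeMap g f) • x := by
  rw [J0, LinearMap.add_apply, LinearMap.add_apply, secondQuant_smul, smul_add,
    LinearMap.smul_apply, LinearMap.smul_apply, LinearMap.id_apply, LinearMap.id_apply]
  rw [smul_comm (Multiset.sum _)]
  abel

lemma J0_ground {N : ℕ} (g : GL (Fin N) ℂ) :
    J0 g (fockMk (modeQuad (formD N) (monodromyGL g))
        (annihilators (monodromyGL g) (zeroPolGL g)) 1)
      = ((g : Matrix (Fin N) (Fin N) ℂ).charpoly.roots.map twistExponent).sum •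
        fockMk (modeQuad (formD N) (monodromyGL g))
          (annihilators (monodromyGL g) (zeroPolGL g)) 1 := by
  rw [J0, LinearMap.add_apply, secondQuant_ground, zero_add]
  rfl

lemma DotGL.L0_mem_module {N : ℕ} (a : DotGL N) {x : FockGL a.g} (hx : x ∈ a.module) :
    a.L0 x ∈ a.module := by
  have hcomm : J0 a.g (a.L0 x) = a.L0 (J0 a.g x) := by
    refine fock_operators_commute (J0_smul a.g) L0_smul (J0_ground a.g) L0_ground
      (fun f => Mode.ext' fun p => ?_) x
    exact map_smul (chargeVec N) (-p) (f.1 p)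
  rw [DotGL.module, Module.End.mem_eigenspace_iff] at hx ⊢
  rw [hcomm, hx, map_smul]

end Modes

/-! ### Isomorphisms of Fock modules -/

section FockMap

variable {M M' : Type} [AddCommGroup M] [Module ℂ M] [AddCommGroup M'] [Module ℂ M']
  {Q : QuadraticForm ℂ M} {Q' : QuadraticForm ℂ M'} {P : Submodule ℂ M} {P' : Submodule ℂ M'}

lemma cliffordMap_mem_evenOdd (f : Q →qᵢ Q') {ε : ZMod 2} {y : CliffordAlgebra Q}
    (hy : y ∈ CliffordAlgebra.evenOdd Q ε) :
    CliffordAlgebra.map f y ∈ CliffordAlgebra.evenOdd Q' ε := by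
  have h : (CliffordAlgebra.evenOdd Q ε).map (CliffordAlgebra.map f).toLinearMap
      ≤ CliffordAlgebra.evenOdd Q' ε := by
    rw [CliffordAlgebra.evenOdd, Submodule.map_iSup]
    refine iSup_le fun j => ?_
    rw [Submodule.map_pow, CliffordAlgebra.ι_range_map_map]
    refine le_trans (pow_le_pow_left' ?_ _)
      (le_iSup (fun j : {n : ℕ // (n : ZMod 2) = ε} =>
        LinearMap.range (CliffordAlgebra.ι Q') ^ (j : ℕ)) j)
    exact Submodule.map_le_iff_le_comap.mpr fun x _ => LinearMap.mem_range_self _ x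
  exact h ⟨y, hy, rfl⟩

lemma cliffordMap_mem_vacIdeal (f : Q →qᵢ Q') (hP : ∀ x ∈ P, f x ∈ P') :
    (vacIdeal Q P).restrictScalars ℂ ≤
      ((vacIdeal Q' P').restrictScalars ℂ).comap (CliffordAlgebra.map f).toLinearMap := by
  intro x hx
  change CliffordAlgebra.map f x ∈ vacIdeal Q' P'
  refine Submodule.span_induction (p := fun x _ => CliffordAlgebra.map f x ∈ vacIdeal Q' P')
    ?_ ?_ ?_ ?_ hx
  · rintro _ ⟨m, hm, rfl⟩
    change CliffordAlgebra.map f (CliffordAlgebra.ι Q m) ∈ _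
    rw [CliffordAlgebra.map_apply_ι]
    exact Submodule.subset_span ⟨f m, hP m hm, rfl⟩
  · rw [map_zero]
    exact zero_mem _
  · intro x y _ _ ihx ihy
    rw [map_add]
    exact add_mem ihx ihy
  · intro a x _ ih
    rw [smul_eq_mul, map_mul]
    exact Submodule.smul_mem _ _ ih

/-- The map of Fock modules induced by an isometry that preserves annihilation operators. -/
def fockMap (f : Q →qᵢ Q') (hP : ∀ x ∈ P, f x ∈ P') : Fock Q P →ₗ[ℂ] Fock Q' P' :=
  (Submodule.Quotient.restrictScalarsEquiv ℂ (vacIdeal Q' P')).toLinearMap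
    ∘ₗ ((vacIdeal Q P).restrictScalars ℂ).mapQ ((vacIdeal Q' P').restrictScalars ℂ)
        (CliffordAlgebra.map f).toLinearMap (cliffordMap_mem_vacIdeal f hP)
    ∘ₗ (Submodule.Quotient.restrictScalarsEquiv ℂ (vacIdeal Q P)).symm.toLinearMap

lemma fockMap_smul (f : Q →qᵢ Q') (hP : ∀ x ∈ P, f x ∈ P') (y : CliffordAlgebra Q)
    (x : Fock Q P) : fockMap f hP (y • x) = CliffordAlgebra.map f y • fockMap f hP x := by
  obtain ⟨z, rfl⟩ := (vacIdeal Q P).mkQ_surjective x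
  change fockMk Q' P' (CliffordAlgebra.map f (y * z)) = _
  rw [map_mul]
  rfl

/-- The isomorphism of Fock modules induced by an invertible isometry that preserves annihilation
operators. -/
def fockEquiv (e : Q.IsometryEquiv Q') (hP : ∀ x, x ∈ P ↔ e x ∈ P') :
    Fock Q P ≃ₗ[ℂ] Fock Q' P' where
  __ := fockMap e.toIsometry fun x hx => (hP x).mp hx
  invFun := fockMap e.symm.toIsometry fun x hx => (hP _).mpr (by
    change e (e.symm x) ∈ P'
    rwa [e.apply_symm_apply])
  left_inv x := by
    obtain ⟨y, rfl⟩ := (vacIdeal Q P).mkQ_surjective x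
    change fockMk Q P (CliffordAlgebra.map _ (CliffordAlgebra.map _ y)) = fockMk Q P y
    rw [CliffordAlgebra.leftInverse_map_of_leftInverse e.toIsometry e.symm.toIsometry
      e.symm_apply_apply]
  right_inv x := by
    obtain ⟨y, rfl⟩ := (vacIdeal Q' P').mkQ_surjective x
    change fockMk Q' P' (CliffordAlgebra.map _ (CliffordAlgebra.map _ y)) = fockMk Q' P' y
    rw [CliffordAlgebra.leftInverse_map_of_leftInverse e.symm.toIsometry e.toIsometry
      e.apply_symm_apply]

lemma fockEquiv_mem_fockParity (e : Q.IsometryEquiv Q') (hP : ∀ x, x ∈ P ↔ e x ∈ P')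
    (ε : ZMod 2) (x : Fock Q P) :
    x ∈ fockParity Q P ε ↔ fockEquiv e hP x ∈ fockParity Q' P' ε := by
  constructor
  · rintro ⟨y, hy, rfl⟩
    exact ⟨_, cliffordMap_mem_evenOdd e.toIsometry hy, rfl⟩
  · rintro ⟨y, hy, h⟩
    refine ⟨_, cliffordMap_mem_evenOdd e.symm.toIsometry hy, ?_⟩
    rw [← (fockEquiv e hP).symm_apply_apply x, ← h]
    rfl

/-- The induced isomorphism of Fock modules intertwines operators that act compatibly on the
generators and on the ground states. -/
lemma fockEquiv_intertwines (e : Q.IsometryEquiv Q') (hP : ∀ x, x ∈ P ↔ e x ∈ P')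
    {T : Module.End ℂ (Fock Q P)} {T' : Module.End ℂ (Fock Q' P')} {A : Module.End ℂ M}
    {A' : Module.End ℂ M'} {c : ℂ}
    (hT : ∀ f x, T (CliffordAlgebra.ι Q f • x)
      = CliffordAlgebra.ι Q f • T x + CliffordAlgebra.ι Q (A f) • x)
    (hT' : ∀ f x, T' (CliffordAlgebra.ι Q' f • x)
      = CliffordAlgebra.ι Q' f • T' x + CliffordAlgebra.ι Q' (A' f) • x)
    (hc : T (fockMk Q P 1) = c • fockMk Q P 1) (hc' : T' (fockMk Q' P' 1) = c • fockMk Q' P' 1)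
    (hA : ∀ f, e (A f) = A' (e f)) (x : Fock Q P) :
    fockEquiv e hP (T x) = T' (fockEquiv e hP x) := by
  have hsmul : ∀ y x, fockEquiv e hP (y • x)
      = CliffordAlgebra.map e.toIsometry y • fockEquiv e hP x :=
    fockMap_smul e.toIsometry fun x hx => (hP x).mp hx
  have hι : ∀ f, CliffordAlgebra.map e.toIsometry (CliffordAlgebra.ι Q f)
      = CliffordAlgebra.ι Q' (e f) := CliffordAlgebra.map_apply_ι e.toIsometry
  have key : ∀ y : CliffordAlgebra Q, ∀ x, fockEquiv e hP (T x) = T' (fockEquiv e hP x) →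
      fockEquiv e hP (T (y • x)) = T' (fockEquiv e hP (y • x)) := by
    intro y
    induction y using CliffordAlgebra.induction with
    | algebraMap r =>
      intro x hx
      rw [algebraMap_smul, map_smul, map_smul, hx, map_smul, map_smul]
    | ι f =>
      intro x hx
      rw [hT, map_add, hsmul, hsmul, hsmul, hι, hι, hT', hx, hA]
    | mul y z hy hz => intro x hx; rw [mul_smul]; exact hy _ (hz _ hx)
    | add y z hy hz =>
      intro x hx
      rw [add_smul, map_add, map_add, map_add, map_add, hy _ hx, hz _ hx]
  obtain ⟨y, rfl⟩ := (vacIdeal Q P).mkQ_surjective x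
  have h1 : fockEquiv e hP (fockMk Q P 1) = fockMk Q' P' 1 := by
    change fockMk Q' P' (CliffordAlgebra.map _ 1) = _
    rw [map_one]
  have h := key y (fockMk Q P 1) (by rw [hc, map_smul, h1, hc'])
  rwa [smul_ground] at h

/-- Multiplication by a generator of non-zero square is invertible on every module over the
Clifford algebra. -/
lemma exists_linearEquiv_ι_smul {F : Type} [AddCommGroup F] [Module ℂ F]
    [Module (CliffordAlgebra Q) F] [IsScalarTower ℂ (CliffordAlgebra Q) F] {u : M} (hu : Q u ≠ 0) :
    ∃ Φ : F ≃ₗ[ℂ] F, ∀ x, Φ x = CliffordAlgebra.ι Q u • x := by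
  refine ⟨{ toFun := fun x => CliffordAlgebra.ι Q u • x
            map_add' := smul_add _
            map_smul' := fun c x => smul_comm _ _ _
            invFun := fun x => (Q u)⁻¹ • CliffordAlgebra.ι Q u • x
            left_inv := fun x => ?_
            right_inv := fun x => ?_ }, fun x => rfl⟩
  · change (Q u)⁻¹ • CliffordAlgebra.ι Q u • CliffordAlgebra.ι Q u • x = x
    rw [ι_smul_ι_smul_self, inv_smul_smul₀ hu]
  · change CliffordAlgebra.ι Q u • (Q u)⁻¹ • CliffordAlgebra.ι Q u • x = x
    rw [smul_comm, ι_smul_ι_smul_self, inv_smul_smul₀ hu]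

lemma ι_smul_mem_fockParity (u : M) {ε : ZMod 2} {x : Fock Q P} (hx : x ∈ fockParity Q P ε) :
    CliffordAlgebra.ι Q u • x ∈ fockParity Q P (ε + 1) := by
  obtain ⟨y, hy, rfl⟩ := hx
  refine ⟨CliffordAlgebra.ι Q u * y, ?_, rfl⟩
  rw [add_comm]
  exact SetLike.mul_mem_graded (CliffordAlgebra.ι_mem_evenOdd_one Q u) hy

/-- If `u` has non-zero square and is fixed by the derivation that an operator `T` induces, then
multiplication by `u` exchanges the two parities, so `T` has the same character on both. -/
lemma character_fockParity_eq {T : Module.End ℂ (Fock Q P)} {u : M} (hu : Q u ≠ 0)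
    (hT : ∀ x, T (CliffordAlgebra.ι Q u • x) = CliffordAlgebra.ι Q u • T x) (ε ε' : ZMod 2)
    (τ : ℂ) : character T (fockParity Q P ε) τ = character T (fockParity Q P ε') τ := by
  obtain ⟨Φ, hΦ⟩ := exists_linearEquiv_ι_smul (F := Fock Q P) hu
  have h : ∀ ε, character T (fockParity Q P ε) τ = character T (fockParity Q P (ε + 1)) τ := by
    refine fun ε => character_congr Φ (fun x => by rw [hΦ, hΦ, hT]) (fun x => ?_) τ
    rw [hΦ]
    refine ⟨ι_smul_mem_fockParity u, fun hx => ?_⟩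
    have h2 := ι_smul_mem_fockParity u hx
    rw [ι_smul_ι_smul_self, add_assoc, show (1 : ZMod 2) + 1 = 0 from rfl, add_zero] at h2
    exact (Submodule.smul_mem_iff _ hu).mp h2
  rcases eq_or_ne ε ε' with rfl | hne
  · rfl
  · rw [h ε]
    congr 2
    revert ε ε'
    decide

end FockMap

/-! ### Transformations of the twisted fields -/

section TwistEquiv

variable {ι : Type} [Fintype ι]

/-- The bilinear form of the operator product expansion, on coefficient vectors. -/
abbrev pairing (S : Matrix ι ι ℂ) (v w : ι → ℂ) : ℂ := dotProduct (Matrix.vecMul v S) w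

/-- An invertible transformation of the fields that preserves their operator products and carries
the monodromy `D` to the monodromy `D'`. -/
structure IsTwistEquiv (S D D' : Matrix ι ι ℂ) (e : (ι → ℂ) ≃ₗ[ℂ] (ι → ℂ)) : Prop where
  monodromy : ∀ v, e (Matrix.vecMul v D) = Matrix.vecMul (e v) D'
  pairing : ∀ v w, pairing S (e v) (e w) = pairing S v w

variable {S D D' : Matrix ι ι ℂ} {e : (ι → ℂ) ≃ₗ[ℂ] (ι → ℂ)}

lemma IsTwistEquiv.refl : IsTwistEquiv S D D (LinearEquiv.refl ℂ _) :=
  ⟨fun _ => rfl, fun _ _ => rfl⟩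

lemma IsTwistEquiv.trans {D'' : Matrix ι ι ℂ} {e' : (ι → ℂ) ≃ₗ[ℂ] (ι → ℂ)}
    (h : IsTwistEquiv S D D' e) (h' : IsTwistEquiv S D' D'' e') :
    IsTwistEquiv S D D'' (e.trans e') :=
  ⟨fun v => by simp [h.monodromy, h'.monodromy], fun v w => by
    simp only [LinearEquiv.trans_apply, h.pairing, h'.pairing]⟩

lemma IsTwistEquiv.symm (h : IsTwistEquiv S D D' e) : IsTwistEquiv S D' D e.symm :=
  ⟨fun v => by rw [e.symm_apply_eq, h.monodromy, e.apply_symm_apply], fun v w => by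
    rw [← h.pairing, e.apply_symm_apply, e.apply_symm_apply]⟩

/-- The induced map on modes. -/
def IsTwistEquiv.modeMap (h : IsTwistEquiv S D D' e) : Mode D →ₗ[ℂ] Mode D' where
  toFun f := ⟨f.1.mapRange e (map_zero e), fun p => by
    rw [Finsupp.mapRange_apply, ← h.monodromy, f.2 p, map_smul]⟩
  map_add' f g := Mode.ext' fun p => map_add e (f.1 p) (g.1 p)
  map_smul' c f := Mode.ext' fun p => map_smul e c (f.1 p)

lemma IsTwistEquiv.modeForm_modeMap (h : IsTwistEquiv S D D' e) (f g : Mode D) :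
    modeForm S D' (h.modeMap f) (h.modeMap g) = modeForm S D f g := by
  rw [modeForm_eq_sum S D f g _ subset_rfl, modeForm_eq_sum S D' (h.modeMap f) (h.modeMap g)
    f.1.support (Finsupp.support_mapRange (hf := map_zero e))]
  exact Finset.sum_congr rfl fun p _ => h.pairing (f.1 p) (g.1 (-p))

/-- The induced isometry on modes. -/
def IsTwistEquiv.modeIsometry (h : IsTwistEquiv S D D' e) :
    (modeQuad S D).IsometryEquiv (modeQuad S D') where
  __ := h.modeMap
  invFun := h.symm.modeMap
  left_inv f := Mode.ext' fun p => e.symm_apply_apply (f.1 p)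
  right_inv f := Mode.ext' fun p => e.apply_symm_apply (f.1 p)
  map_app' f := congrArg ((2⁻¹ : ℂ) * ·) (h.modeForm_modeMap f f)

lemma IsTwistEquiv.mem_annihilators (h : IsTwistEquiv S D D' e) {L L' : Submodule ℂ (ι → ℂ)}
    (hL : L.map e.toLinearMap = L') (f : Mode D) :
    f ∈ annihilators D L ↔ h.modeIsometry f ∈ annihilators D' L' := by
  subst hL
  refine and_congr ?_ (forall_congr' fun p => imp_congr_right fun _ => imp_congr_right fun _ => ?_)
  · change f.1 0 ∈ L ↔ e (f.1 0) ∈ L.map e.toLinearMap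
    exact ⟨fun h => ⟨_, h, rfl⟩, fun ⟨w, hw, hew⟩ => e.injective hew ▸ hw⟩
  · exact (e.map_eq_zero_iff (x := f.1 p)).symm

/-- The isomorphism of twisted Fock modules induced by a transformation of the fields. -/
def IsTwistEquiv.fock (h : IsTwistEquiv S D D' e) {L L' : Submodule ℂ (ι → ℂ)}
    (hL : L.map e.toLinearMap = L') : TwistedFock S D L ≃ₗ[ℂ] TwistedFock S D' L' :=
  fockEquiv h.modeIsometry (h.mem_annihilators hL)

lemma IsTwistEquiv.fock_L0 [DecidableEq ι] (h : IsTwistEquiv S D D' e)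
    {L L' : Submodule ℂ (ι → ℂ)} (hL : L.map e.toLinearMap = L')
    (hw : groundWeight D = groundWeight D') (x : TwistedFock S D L) :
    h.fock hL (L0 S D L x) = L0 S D' L' (h.fock hL x) :=
  fockEquiv_intertwines _ _ L0_smul L0_smul L0_ground (hw ▸ L0_ground)
    (fun f => Mode.ext' fun p => map_smul e (-p) (f.1 p)) x

lemma IsTwistEquiv.mem_zeroModes (h : IsTwistEquiv S D D' e) (v : ι → ℂ) :
    e v ∈ zeroModes D' ↔ v ∈ zeroModes D := by
  change Matrix.vecMul (e v) D' = -e v ↔ Matrix.vecMul v D = -v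
  rw [← h.monodromy, ← map_neg, e.injective.eq_iff]

lemma IsTwistEquiv.polarization (h : IsTwistEquiv S D D' e) {L : Submodule ℂ (ι → ℂ)}
    (hL : IsZeroModePolarization S D L) : IsZeroModePolarization S D' (L.map e.toLinearMap) := by
  refine ⟨⟨?_, ?_⟩, fun L' hL' hle => ?_⟩
  · rintro _ ⟨v, hv, rfl⟩
    exact (h.mem_zeroModes v).mpr (hL.prop.1 hv)
  · rintro _ ⟨v, hv, rfl⟩ _ ⟨w, hw, rfl⟩
    exact (h.pairing v w).trans (hL.prop.2 v hv w hw)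
  · have h1 := hL.le_of_ge (y := L'.map e.symm.toLinearMap) ⟨?_, ?_⟩ ?_
    · intro v hv
      exact ⟨e.symm v, h1 ⟨v, hv, rfl⟩, e.apply_symm_apply v⟩
    · rintro _ ⟨v, hv, rfl⟩
      exact (h.symm.mem_zeroModes v).mpr (hL'.1 hv)
    · rintro _ ⟨v, hv, rfl⟩ _ ⟨w, hw, rfl⟩
      exact (h.symm.pairing v w).trans (hL'.2 v hv w hw)
    · intro v hv
      exact ⟨e v, hle ⟨v, hv, rfl⟩, e.symm_apply_apply v⟩

/-! ### Witt's theorem for polarizations of the zero modes -/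

section Witt

lemma pairing_comm (hS : S.transpose = S) (v w : ι → ℂ) : pairing S v w = pairing S w v := by
  rw [pairing, pairing, ← Matrix.dotProduct_mulVec, dotProduct_comm, ← Matrix.vecMul_transpose, hS]

lemma pairing_add_left (v v' w : ι → ℂ) :
    pairing S (v + v') w = pairing S v w + pairing S v' w := by
  rw [pairing, Matrix.add_vecMul, add_dotProduct]

lemma pairing_add_right (v w w' : ι → ℂ) :
    pairing S v (w + w') = pairing S v w + pairing S v w' := dotProduct_add _ _ _

lemma pairing_smul_left (c : ℂ) (v w : ι → ℂ) : pairing S (c • v) w = c * pairing S v w := by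
  rw [pairing, Matrix.smul_vecMul, smul_dotProduct, smul_eq_mul]

lemma pairing_smul_right (c : ℂ) (v w : ι → ℂ) : pairing S v (c • w) = c * pairing S v w :=
  dotProduct_smul _ _ _

lemma pairing_neg_right (v w : ι → ℂ) : pairing S v (-w) = -pairing S v w := dotProduct_neg _ _

lemma pairing_neg_left (v w : ι → ℂ) : pairing S (-v) w = -pairing S v w := by
  rw [pairing, Matrix.neg_vecMul, neg_dotProduct]

/-- Distinct maximal isotropic spaces of zero modes contain vectors that pair to one. -/
lemma IsZeroModePolarization.exists_pairing_eq_one (hS : S.transpose = S)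
    {L L' : Submodule ℂ (ι → ℂ)} (hL : IsZeroModePolarization S D L)
    (hL' : IsZeroModePolarization S D L') (hne : L ≠ L') :
    ∃ l ∈ L, ∃ l' ∈ L', pairing S l l' = 1 := by
  have hnle : ¬ L ≤ L' := fun h => hne (hL.eq_of_ge hL'.prop h).symm
  obtain ⟨l, hl, hl'⟩ := SetLike.not_le_iff_exists.mp hnle
  by_contra! hcon
  have hz : ∀ x ∈ L', pairing S l x = 0 := by
    intro x hx
    by_contra h
    refine hcon l hl ((pairing S l x)⁻¹ • x) (L'.smul_mem _ hx) ?_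
    rw [pairing_smul_right, inv_mul_cancel₀ h]
  refine hl' (hL'.le_of_ge (y := L' ⊔ Submodule.span ℂ {l}) ⟨?_, ?_⟩ le_sup_left
    (Submodule.mem_sup_right (Submodule.mem_span_singleton_self l)))
  · exact sup_le hL'.prop.1 ((Submodule.span_singleton_le_iff_mem _ _).mpr (hL.prop.1 hl))
  · intro v hv w hw
    obtain ⟨x, hx, _, hy, rfl⟩ := Submodule.mem_sup.mp hv
    obtain ⟨a, rfl⟩ := Submodule.mem_span_singleton.mp hy
    obtain ⟨x', hx', _, hy', rfl⟩ := Submodule.mem_sup.mp hw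
    obtain ⟨b, rfl⟩ := Submodule.mem_span_singleton.mp hy'
    change pairing S (x + a • l) (x' + b • l) = 0
    have h1 : pairing S x x' = 0 := hL'.prop.2 x hx x' hx'
    have h2 : pairing S l l = 0 := hL.prop.2 l hl l hl
    simp only [pairing_add_left, pairing_add_right, pairing_smul_left, pairing_smul_right, h1, h2,
      hz x' hx', pairing_comm hS x l, hz x hx, mul_zero, add_zero]

/-- The reflection `v ↦ v + (v, u) u` in a zero mode `u` with `(u, u) = -2` commutes with the
monodromy. -/
lemma exists_reflection [DecidableEq ι] (hS : S.transpose = S) (hD : D * S * D.transpose = S)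
    {u : ι → ℂ} (hu : u ∈ zeroModes D) (huu : pairing S u u = -2) :
    ∃ e : (ι → ℂ) ≃ₗ[ℂ] (ι → ℂ), IsTwistEquiv S D D e ∧ ∀ v, e v = v + pairing S v u • u := by
  let r : (ι → ℂ) →ₗ[ℂ] (ι → ℂ) :=
    { toFun := fun v => v + pairing S v u • u
      map_add' := fun v w => by rw [pairing_add_left]; module
      map_smul' := fun c v => by rw [pairing_smul_left, RingHom.id_apply]; module }
  have hr : ∀ v, r (r v) = v := fun v => by
    change v + pairing S v u • u + pairing S (v + pairing S v u • u) u • u = v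
    rw [pairing_add_left, pairing_smul_left, huu]
    module
  have hpD : ∀ v w, pairing S (Matrix.vecMul v D) (Matrix.vecMul w D) = pairing S v w := by
    intro v w
    rw [pairing, pairing, ← Matrix.mulVec_transpose D w, Matrix.dotProduct_mulVec,
      Matrix.vecMul_vecMul, Matrix.vecMul_vecMul, ← Matrix.mul_assoc, hD]
  have hu' : Matrix.vecMul u D = -u := hu
  refine ⟨LinearEquiv.ofInvolutive r hr, ⟨fun v => ?_, fun v w => ?_⟩, fun v => rfl⟩
  · change Matrix.vecMul v D + pairing S (Matrix.vecMul v D) u • u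
      = Matrix.vecMul (v + pairing S v u • u) D
    have h1 : pairing S (Matrix.vecMul v D) u = -pairing S v u := by
      rw [← hpD v u, hu', pairing_neg_right, neg_neg]
    rw [h1, Matrix.add_vecMul, Matrix.smul_vecMul, hu']
    module
  · change pairing S (v + pairing S v u • u) (w + pairing S w u • u) = pairing S v w
    simp only [pairing_add_left, pairing_add_right, pairing_smul_left, pairing_smul_right, huu,
      pairing_comm hS u w]
    ring

/-- Witt's theorem for zero modes: any two maximal isotropic spaces of zero modes are related by a
transformation of the fields that commutes with the monodromy. -/
lemma IsZeroModePolarization.exists_twistEquiv [DecidableEq ι] (hS : S.transpose = S)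
    (hD : D * S * D.transpose = S) {L' : Submodule ℂ (ι → ℂ)}
    (hL' : IsZeroModePolarization S D L') (n : ℕ) : ∀ L : Submodule ℂ (ι → ℂ),
      IsZeroModePolarization S D L → Module.finrank ℂ L' ≤ Module.finrank ℂ ↥(L ⊓ L') + n →
      ∃ e : (ι → ℂ) ≃ₗ[ℂ] (ι → ℂ), IsTwistEquiv S D D e ∧ L.map e.toLinearMap = L' := by
  induction n with
  | zero =>
    intro L hL hn
    have h1 : L ⊓ L' = L' := Submodule.eq_of_le_of_finrank_le inf_le_right hn
    refine ⟨LinearEquiv.refl ℂ _, IsTwistEquiv.refl, ?_⟩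
    rw [LinearEquiv.refl_toLinearMap, Submodule.map_id]
    exact hL'.eq_of_le hL.prop (inf_eq_right.mp h1) |>.symm
  | succ n ih =>
    intro L hL hn
    by_cases hne : L = L'
    · refine ⟨LinearEquiv.refl ℂ _, IsTwistEquiv.refl, ?_⟩
      rw [LinearEquiv.refl_toLinearMap, Submodule.map_id, hne]
    obtain ⟨l, hl, l', hl', hll'⟩ := hL.exists_pairing_eq_one hS hL' hne
    have hll : pairing S l l = 0 := hL.prop.2 l hl l hl
    have hll2 : pairing S l' l' = 0 := hL'.prop.2 l' hl' l' hl'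
    -- the reflection in `l - l'` exchanges `l` and `l'` and fixes `L ⊓ L'`
    obtain ⟨e, he, hev⟩ := exists_reflection hS hD (u := l + -l')
      (add_mem (hL.prop.1 hl) (neg_mem (hL'.prop.1 hl'))) (by
        simp only [pairing_add_left, pairing_add_right, pairing_neg_left, pairing_neg_right, hll,
          hll2, hll', pairing_comm hS l' l]
        norm_num)
    have hel : e l = l' := by
      rw [hev, pairing_add_right, pairing_neg_right, hll, hll']
      module
    have hfix : ∀ x ∈ L ⊓ L', e x = x := by
      rintro x ⟨hx, hx'⟩
      have h1 : pairing S x l = 0 := hL.prop.2 x hx l hl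
      have h2 : pairing S x l' = 0 := hL'.prop.2 x hx' l' hl'
      rw [hev, pairing_add_right, pairing_neg_right, h1, h2]
      module
    have hlt : L ⊓ L' < L.map e.toLinearMap ⊓ L' := by
      refine SetLike.lt_iff_le_and_exists.mpr ⟨fun x hx => ⟨⟨x, hx.1, hfix x hx⟩, hx.2⟩,
        l', Submodule.mem_inf.mpr ⟨⟨l, hl, hel⟩, hl'⟩, fun h => ?_⟩
      have h3 : pairing S l l' = 0 := hL.prop.2 l hl l' h.1
      rw [hll'] at h3
      exact one_ne_zero h3
    have hrank := Submodule.finrank_lt_finrank_of_lt hlt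
    obtain ⟨e', he', hmap⟩ := ih _ (he.polarization hL) (by omega)
    refine ⟨e.trans e', he.trans he', ?_⟩
    rw [← hmap, LinearEquiv.coe_trans, Submodule.map_comp]

end Witt

end TwistEquiv

/-! ### Conjugate monodromies -/

section Conjugation

variable {ι : Type} [Fintype ι] [DecidableEq ι]

/-- Right multiplication of row vectors by an invertible matrix. -/
def vecMulEquiv (Ω : GL ι ℂ) : (ι → ℂ) ≃ₗ[ℂ] (ι → ℂ) where
  __ := Matrix.vecMulLinear (Ω : Matrix ι ι ℂ)
  invFun := Matrix.vecMulLinear ((Ω⁻¹ : GL ι ℂ) : Matrix ι ι ℂ)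
  left_inv v := by simp
  right_inv v := by simp

lemma isTwistEquiv_vecMulEquiv {S D D' : Matrix ι ι ℂ} {Ω : GL ι ℂ} (hΩ : Ω ∈ orthogonal S)
    (h : D * Ω = Ω * D') : IsTwistEquiv S D D' (vecMulEquiv Ω) := by
  refine ⟨fun v => ?_, fun v w => ?_⟩
  · change Matrix.vecMul (Matrix.vecMul v D) Ω = Matrix.vecMul (Matrix.vecMul v Ω) D'
    rw [Matrix.vecMul_vecMul, Matrix.vecMul_vecMul, h]
  · change dotProduct (Matrix.vecMul (Matrix.vecMul v Ω) S) (Matrix.vecMul w Ω) = _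
    have hΩ : (Ω : Matrix ι ι ℂ) * S * (Ω : Matrix ι ι ℂ).transpose = S := hΩ
    rw [← Matrix.mulVec_transpose _ w, Matrix.dotProduct_mulVec, Matrix.vecMul_vecMul,
      Matrix.vecMul_vecMul, ← Matrix.mul_assoc, hΩ]

lemma groundWeight_eq_of_mul_eq {D D' : Matrix ι ι ℂ} {Ω : GL ι ℂ} (h : D * Ω = Ω * D') :
    groundWeight D = groundWeight D' := by
  have h1 : D = Ω * D' * ((Ω⁻¹ : GL ι ℂ) : Matrix ι ι ℂ) := by
    rw [← h, Matrix.mul_assoc, ← Units.val_mul, mul_inv_cancel, Units.val_one, Matrix.mul_one]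
  rw [groundWeight, groundWeight, h1, Matrix.coe_units_inv]
  congr 3
  exact Matrix.charpoly_units_conj Ω D'

lemma mul_eq_of_eq_conj {g g' Ω : GL ι ℂ} (h : g = Ω * g' * Ω⁻¹) :
    (g : Matrix ι ι ℂ) * Ω = Ω * (g' : Matrix ι ι ℂ) := by
  rw [← Units.val_mul, ← Units.val_mul, h, inv_mul_cancel_right]

/-- For conjugate monodromies and arbitrary polarizations of the zero modes, the twisted Fock
modules are isomorphic as graded modules, with the same parity. -/
lemma exists_twistEquiv_of_conj {S : Matrix ι ι ℂ} (hS : S.transpose = S) {g g' Ω : GL ι ℂ}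
    (hg' : g' ∈ orthogonal S) (hΩ : Ω ∈ orthogonal S) (h : g = Ω * g' * Ω⁻¹)
    {L L' : Submodule ℂ (ι → ℂ)} (hL : IsZeroModePolarization S (g : Matrix ι ι ℂ) L)
    (hL' : IsZeroModePolarization S (g' : Matrix ι ι ℂ) L') :
    ∃ e, IsTwistEquiv S (g : Matrix ι ι ℂ) (g' : Matrix ι ι ℂ) e ∧ L.map e.toLinearMap = L' := by
  have h1 := isTwistEquiv_vecMulEquiv hΩ (mul_eq_of_eq_conj h)
  obtain ⟨e, he, hmap⟩ := hL'.exists_twistEquiv hS hg' _ _ (h1.polarization hL)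
    (Nat.le_add_left _ _)
  refine ⟨_, h1.trans he, ?_⟩
  rw [← hmap, LinearEquiv.coe_trans, Submodule.map_comp]

/-- If the zero modes have two different polarizations, then the two parities have the same
character. -/
lemma character_fockParity_eq_of_ne {S D : Matrix ι ι ℂ} (hS : S.transpose = S)
    {L L' : Submodule ℂ (ι → ℂ)} (hL : IsZeroModePolarization S D L)
    (hL' : IsZeroModePolarization S D L') (hne : L' ≠ L) (ε ε' : ZMod 2) (τ : ℂ) :
    character (L0 S D L) (fockParity (modeQuad S D) (annihilators D L) ε) τ
      = character (L0 S D L) (fockParity (modeQuad S D) (annihilators D L) ε') τ := by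
  obtain ⟨l, hl, l', hl', hll'⟩ := hL.exists_pairing_eq_one hS hL' hne.symm
  have hu : l + l' ∈ zeroModes D := add_mem (hL.prop.1 hl) (hL'.prop.1 hl')
  have hu' : l + l' ∈ Module.End.eigenspace (Matrix.vecMulLinear D)
      (-Complex.exp (-(2 * Real.pi * Complex.I * 0))) := by
    rw [Module.End.mem_eigenspace_iff]
    rw [mul_zero, neg_zero, Complex.exp_zero, neg_one_smul]
    exact hu
  set f : Mode D := modeSingle D 0 ⟨l + l', hu'⟩ with hf
  have hf0 : f.1 = Finsupp.single 0 (l + l') := rfl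
  have hQ : modeQuad S D f = 1 := by
    have h1 : modeForm S D f f = pairing S (l + l') (l + l') := by
      rw [modeForm_eq_sum S D f f {0} (hf0 ▸ Finsupp.support_single_subset), Finset.sum_singleton,
        hf0, neg_zero, Finsupp.single_eq_same]
    change (2⁻¹ : ℂ) * modeForm S D f f = 1
    have h2 : pairing S l l = 0 := hL.prop.2 l hl l hl
    have h3 : pairing S l' l' = 0 := hL'.prop.2 l' hl' l' hl'
    rw [h1]
    simp only [pairing_add_left, pairing_add_right, h2, h3, hll', pairing_comm hS l' l]
    norm_num
  refine character_fockParity_eq (u := f) (by rw [hQ]; exact one_ne_zero) (fun x => ?_) ε ε' τ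
  rw [L0_smul, hf, energyMap_modeSingle, neg_zero, zero_smul, map_zero, zero_smul, add_zero]

end Conjugation

/-! ### The orthogonal groups -/

section Orthogonal

lemma formD_transpose (N : ℕ) : (formD N).transpose = formD N := by
  simp [formD, Matrix.fromBlocks_transpose]

lemma formB_transpose (N : ℕ) : (formB N).transpose = formB N := by
  simp [formB, Matrix.fromBlocks_transpose, formD_transpose]

lemma DotD.hasCharacter {N : ℕ} (a : DotD N) : HasCharacter a.L0 a.module :=
  hasCharacter_L0 fun _ hx => L0_mem_fockParity _ hx

lemma DotD.chi_eq {N : ℕ} {a b : DotD N} (h : a.Conj b) (τ : ℂ) : a.chi τ = b.chi τ := by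
  obtain ⟨Ω, hΩ, hconj, hpar⟩ := h
  have hS := formD_transpose N
  obtain ⟨e, he, hmap⟩ := exists_twistEquiv_of_conj hS b.mem_orthogonal hΩ hconj a.pol b.pol
  have h1 : a.chi τ = character b.L0 (fockParity
      (modeQuad (formD N) (b.g : Matrix (IdxD N) (IdxD N) ℂ))
      (annihilators (b.g : Matrix (IdxD N) (IdxD N) ℂ) b.L) a.parity) τ :=
    character_congr (he.fock hmap)
      (he.fock_L0 hmap (groundWeight_eq_of_mul_eq (mul_eq_of_eq_conj hconj)))
      (fockEquiv_mem_fockParity _ _ _) τ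
  rw [h1]
  have hΩe := isTwistEquiv_vecMulEquiv hΩ (mul_eq_of_eq_conj hconj)
  by_cases hne : a.L.map (vecMulEquiv Ω).toLinearMap = b.L
  · have hpar' : b.parity = a.parity := by
      have h2 : a.L.map (Matrix.vecMulLinear (Ω : Matrix (IdxD N) (IdxD N) ℂ)) = b.L := hne
      have h3 : Module.finrank ℂ b.L = Module.finrank ℂ a.L := by
        rw [← hne]
        exact LinearEquiv.finrank_map_eq (vecMulEquiv Ω) a.L
      rw [hpar, h2, inf_idem, h3, sub_self, add_zero]
    rw [DotD.chi, DotD.module, hpar']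
  · exact character_fockParity_eq_of_ne hS b.pol (hΩe.polarization a.pol) hne _ _ τ

lemma DotB.hasCharacter_top {N : ℕ} (a : DotB N) : HasCharacter a.L0 ⊤ :=
  hasCharacter_L0 fun _ _ => Submodule.mem_top

lemma DotB.hasCharacter_part {N : ℕ} (a : DotB N) (ε : ZMod 2) : HasCharacter a.L0 (a.part ε) :=
  hasCharacter_L0 fun _ hx => L0_mem_fockParity _ hx

lemma DotB.chi_eq {N : ℕ} {a b : DotB N} (h : a.Conj b) (τ : ℂ) :
    a.chiPlus τ = b.chiPlus τ ∧ a.chiMinus τ = b.chiMinus τ := by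
  obtain ⟨Ω, hΩ, hconj⟩ := h
  obtain ⟨e, he, hmap⟩ :=
    exists_twistEquiv_of_conj (formB_transpose N) b.mem_orthogonal hΩ hconj a.pol b.pol
  have hL0 := he.fock_L0 hmap (groundWeight_eq_of_mul_eq (mul_eq_of_eq_conj hconj))
  have hpart : ∀ ε, character a.L0 (a.part ε) τ = character b.L0 (b.part ε) τ := fun ε =>
    character_congr (he.fock hmap) hL0 (fockEquiv_mem_fockParity _ _ _) τ
  refine ⟨character_congr (he.fock hmap) hL0 (fun x => by simp) τ, ?_⟩
  rw [DotB.chiMinus, DotB.chiMinus, hpart, hpart]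

end Orthogonal

/-! ### The general linear group -/

section GeneralLinear

variable {N : ℕ}

/-- The transformation of the fields `ψ*`, `ψ` by an element of `GL(N)`. -/
def fieldGL (Ω : GL (Fin N) ℂ) : GL (IdxD N) ℂ where
  val := monodromyGL Ω
  inv := monodromyGL Ω⁻¹
  val_inv := by
    rw [monodromyGL, monodromyGL, Matrix.fromBlocks_multiply]
    simp only [Matrix.mul_zero, Matrix.zero_mul, add_zero, zero_add, ← Matrix.transpose_mul,
      ← Units.val_mul, mul_inv_cancel, inv_inv, Units.val_one,
      Matrix.transpose_one, Matrix.fromBlocks_one]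
  inv_val := by
    rw [monodromyGL, monodromyGL, Matrix.fromBlocks_multiply]
    simp only [Matrix.mul_zero, Matrix.zero_mul, add_zero, zero_add, ← Matrix.transpose_mul,
      ← Units.val_mul, inv_mul_cancel, inv_inv, Units.val_one,
      Matrix.transpose_one, Matrix.fromBlocks_one]

lemma monodromyGL_mul (g h : GL (Fin N) ℂ) :
    monodromyGL (g * h) = monodromyGL g * monodromyGL h := by
  rw [monodromyGL, monodromyGL, monodromyGL, Matrix.fromBlocks_multiply]
  simp only [Matrix.mul_zero, Matrix.zero_mul, add_zero, zero_add, ← Matrix.transpose_mul,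
    ← Units.val_mul, mul_inv_rev]

lemma fieldGL_mem_orthogonal (Ω : GL (Fin N) ℂ) : fieldGL Ω ∈ orthogonal (formD N) := by
  change monodromyGL Ω * formD N * (monodromyGL Ω).transpose = formD N
  rw [monodromyGL, formD, Matrix.fromBlocks_transpose, Matrix.fromBlocks_multiply,
    Matrix.fromBlocks_multiply]
  simp only [Matrix.mul_zero, Matrix.zero_mul, add_zero, zero_add, Matrix.mul_one,
    ← Matrix.transpose_mul, Matrix.transpose_transpose, Matrix.transpose_zero,
    ← Units.val_mul, mul_inv_cancel, Units.val_one, Matrix.transpose_one]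

lemma map_zeroPolGL {g g' Ω : GL (Fin N) ℂ}
    (he : IsTwistEquiv (formD N) (monodromyGL g) (monodromyGL g') (vecMulEquiv (fieldGL Ω))) :
    (zeroPolGL g).map (vecMulEquiv (fieldGL Ω)).toLinearMap = zeroPolGL g' := by
  have hinl : ∀ (Ω : GL (Fin N) ℂ) (v : IdxD N → ℂ), (fun i => v (Sum.inl i)) = 0 →
      (fun i => Matrix.vecMul v (monodromyGL Ω) (Sum.inl i)) = 0 := by
    intro Ω v hv
    funext i
    have hv' : ∀ j, v (Sum.inl j) = 0 := fun j => congrFun hv j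
    simp [Matrix.vecMul, dotProduct, monodromyGL, hv']
  ext w
  rw [Submodule.mem_map]
  constructor
  · rintro ⟨v, ⟨hv, hv'⟩, rfl⟩
    exact ⟨(he.mem_zeroModes v).mpr hv, hinl Ω v hv'⟩
  · rintro ⟨hw, hw'⟩
    exact ⟨(vecMulEquiv (fieldGL Ω)).symm w, ⟨(he.symm.mem_zeroModes w).mpr hw, hinl Ω⁻¹ w hw'⟩,
      (vecMulEquiv (fieldGL Ω)).apply_symm_apply w⟩

lemma DotGL.hasCharacter (a : DotGL N) : HasCharacter a.L0 a.module :=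
  hasCharacter_L0 fun _ hx => a.L0_mem_module hx

lemma DotGL.chi_eq {a b : DotGL N} (h : a.Conj b) (τ : ℂ) : a.chi τ = b.chi τ := by
  obtain ⟨⟨Ω, hconj⟩, ht⟩ := h
  have hmul : monodromyGL a.g * (fieldGL Ω : Matrix (IdxD N) (IdxD N) ℂ)
      = (fieldGL Ω : Matrix (IdxD N) (IdxD N) ℂ) * monodromyGL b.g := by
    change monodromyGL a.g * monodromyGL Ω = monodromyGL Ω * monodromyGL b.g
    rw [← monodromyGL_mul, ← monodromyGL_mul, hconj, inv_mul_cancel_right]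
  have he := isTwistEquiv_vecMulEquiv (fieldGL_mem_orthogonal Ω) hmul
  have hmap := map_zeroPolGL he
  have hchar : (a.g : Matrix (Fin N) (Fin N) ℂ).charpoly
      = (b.g : Matrix (Fin N) (Fin N) ℂ).charpoly := by
    rw [hconj, Units.val_mul, Units.val_mul, Matrix.coe_units_inv]
    exact Matrix.charpoly_units_conj Ω (b.g : Matrix (Fin N) (Fin N) ℂ)
  have hJ : ∀ x, he.fock hmap (J0 a.g x) = J0 b.g (he.fock hmap x) :=
    fockEquiv_intertwines _ _ (J0_smul a.g) (J0_smul b.g) (J0_ground a.g)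
      (by rw [hchar]; exact J0_ground b.g)
      (fun f => Mode.ext' fun p => (chargeVec_vecMul Ω (f.1 p)))
  refine character_congr (he.fock hmap) (he.fock_L0 hmap (groundWeight_eq_of_mul_eq hmul))
    (fun x => ?_) τ
  rw [DotGL.module, DotGL.module, Module.End.mem_eigenspace_iff, Module.End.mem_eigenspace_iff,
    ← hJ, ht, ← map_smul, (he.fock hmap).injective.eq_iff]

end GeneralLinear

open Filter Topology

/-! ### Finite products of series -/

section PiProducts

variable {κ : Type} [Fintype κ] {α : κ → Type}

lemma summable_norm_pi_prod {f : ∀ i, α i → ℂ} (hf : ∀ i, Summable fun a => ‖f i a‖) :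
    Summable fun x : ∀ i, α i => ‖∏ i, f i (x i)‖ := by
  classical
  refine summable_of_sum_le (c := ∏ i, ∑' a, ‖f i a‖) (fun _ => norm_nonneg _) fun u => ?_
  calc ∑ x ∈ u, ‖∏ i, f i (x i)‖
      ≤ ∑ x ∈ Fintype.piFinset fun i => u.image fun x => x i, ∏ i, ‖f i (x i)‖ := by
        simp only [norm_prod]
        refine Finset.sum_le_sum_of_subset_of_nonneg (fun x hx => ?_)
          fun x _ _ => Finset.prod_nonneg fun i _ => norm_nonneg _
        exact Fintype.mem_piFinset.mpr fun i => Finset.mem_image_of_mem _ hx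
    _ = ∏ i, ∑ a ∈ u.image fun x => x i, ‖f i a‖ := by rw [Finset.prod_univ_sum]
    _ ≤ ∏ i, ∑' a, ‖f i a‖ := Finset.prod_le_prod
        (fun i _ => Finset.sum_nonneg fun a _ => norm_nonneg _)
        fun i _ => (hf i).sum_le_tsum _ fun a _ => norm_nonneg _

/-- A finite product of absolutely convergent series is the series of the products. -/
lemma tsum_pi_prod {f : ∀ i, α i → ℂ} (hf : ∀ i, Summable fun a => ‖f i a‖) :
    ∑' x : ∀ i, α i, ∏ i, f i (x i) = ∏ i, ∑' a, f i a := by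
  classical
  have h1 : Tendsto (fun t : ∀ i, Finset (α i) => Fintype.piFinset t) atTop atTop := by
    refine tendsto_atTop.mpr fun u => ?_
    filter_upwards [eventually_ge_atTop fun i => u.image fun x => x i] with t ht
    exact fun x hx => Fintype.mem_piFinset.mpr fun i => ht i (Finset.mem_image_of_mem _ hx)
  have h2 := (summable_norm_pi_prod hf).of_norm.hasSum.comp h1
  have h3 : Tendsto (fun t : ∀ i, Finset (α i) => ∏ i, ∑ a ∈ t i, f i a) atTop
      (𝓝 (∏ i, ∑' a, f i a)) := by
    refine tendsto_finsetProd _ fun i _ => ?_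
    have h4 : Tendsto (fun t : ∀ i, Finset (α i) => t i) atTop atTop :=
      tendsto_atTop_atTop.mpr fun b => ⟨fun j => if h : i = j then h ▸ b else ∅, fun t ht => by
        have := ht i
        simpa using this⟩
    exact (hf i).of_norm.hasSum.comp h4
  refine tendsto_nhds_unique h2 (h3.congr fun t => ?_)
  exact Finset.prod_univ_sum _ _

end PiProducts

/-! ### The Jacobi triple product -/

section TripleProduct

/-- The finite product `(1 - q) ⋯ (1 - qⁿ)`. -/
def qFactor (q : ℂ) (n : ℕ) : ℂ := ∏ i ∈ Finset.range n, (1 - q ^ (i + 1))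

/-- The infinite product `∏ (1 - qⁿ)`. -/
def eulerProd (q : ℂ) : ℂ := ∏' n : ℕ, (1 - q ^ (n + 1))

/-- The Gaussian binomial coefficient. -/
def gaussBinom (q : ℂ) (n k : ℕ) : ℂ :=
  if k ≤ n then qFactor q n / (qFactor q k * qFactor q (n - k)) else 0

variable {q : ℂ}

lemma one_sub_pow_ne_zero (hq : ‖q‖ < 1) (n : ℕ) : 1 - q ^ (n + 1) ≠ 0 := by
  intro h
  have h1 : ‖q ^ (n + 1)‖ < 1 := by
    rw [norm_pow]
    exact pow_lt_one₀ (norm_nonneg _) hq (Nat.succ_ne_zero n)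
  rw [← sub_eq_zero.mp h, norm_one] at h1
  exact h1.false

lemma qFactor_ne_zero (hq : ‖q‖ < 1) (n : ℕ) : qFactor q n ≠ 0 :=
  Finset.prod_ne_zero_iff.mpr fun i _ => one_sub_pow_ne_zero hq i

lemma qFactor_succ (n : ℕ) : qFactor q (n + 1) = qFactor q n * (1 - q ^ (n + 1)) :=
  Finset.prod_range_succ _ _

lemma qFactor_zero : qFactor q 0 = 1 := Finset.prod_range_zero _

lemma gaussBinom_zero (hq : ‖q‖ < 1) (n : ℕ) : gaussBinom q n 0 = 1 := by
  rw [gaussBinom, if_pos n.zero_le, qFactor_zero, Nat.sub_zero, one_mul,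
    div_self (qFactor_ne_zero hq n)]

lemma gaussBinom_of_lt {n k : ℕ} (h : n < k) : gaussBinom q n k = 0 := if_neg (by omega)

lemma gaussBinom_succ_succ (hq : ‖q‖ < 1) {n k : ℕ} (h : k ≤ n) :
    gaussBinom q (n + 1) (k + 1) = gaussBinom q n (k + 1) + q ^ (n - k) * gaussBinom q n k := by
  obtain ⟨c, rfl⟩ := Nat.exists_eq_add_of_le h
  have h1 := qFactor_ne_zero hq
  have h2 := one_sub_pow_ne_zero hq
  rcases c with _ | c
  · rw [gaussBinom_of_lt (n := k + 0) (Nat.lt_succ_self _)]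
    simp [qFactor_zero, h1, gaussBinom]
  · rw [gaussBinom, gaussBinom, gaussBinom, if_pos (by omega), if_pos (by omega), if_pos (by omega),
      show k + (c + 1) + 1 - (k + 1) = c + 1 by omega, show k + (c + 1) - (k + 1) = c by omega,
      show k + (c + 1) - k = c + 1 by omega, qFactor_succ (k + (c + 1)), qFactor_succ k,
      qFactor_succ c]
    have h3 := h1 k
    have h4 := h1 c
    have h5 := h2 k
    have h6 := h2 c
    field_simp
    ring

/-- The finite `q`-binomial theorem. -/
lemma prod_one_add_mul_pow (hq : ‖q‖ < 1) (x : ℂ) (n : ℕ) :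
    ∏ j ∈ Finset.range n, (1 + x * q ^ j)
      = ∑ k ∈ Finset.range (n + 1), gaussBinom q n k * (q ^ (∑ i ∈ Finset.range k, i) * x ^ k) := by
  induction n with
  | zero => simp [gaussBinom_zero hq]
  | succ n ih =>
    rw [Finset.prod_range_succ, ih, Finset.sum_range_succ' _ (n + 1)]
    have h1 : ∑ k ∈ Finset.range (n + 1),
          gaussBinom q (n + 1) (k + 1) * (q ^ (∑ i ∈ Finset.range (k + 1), i) * x ^ (k + 1))
        = ∑ k ∈ Finset.range (n + 1),
            gaussBinom q n (k + 1) * (q ^ (∑ i ∈ Finset.range (k + 1), i) * x ^ (k + 1))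
          + x * q ^ n * ∑ k ∈ Finset.range (n + 1),
            gaussBinom q n k * (q ^ (∑ i ∈ Finset.range k, i) * x ^ k) := by
      rw [Finset.mul_sum, ← Finset.sum_add_distrib]
      refine Finset.sum_congr rfl fun k hk => ?_
      have hk : k ≤ n := Nat.lt_succ_iff.mp (Finset.mem_range.mp hk)
      have hpow : q ^ n = q ^ (n - k) * q ^ k := by rw [← pow_add, Nat.sub_add_cancel hk]
      rw [gaussBinom_succ_succ hq hk, Finset.sum_range_succ, hpow]
      ring
    have h2 := Finset.sum_range_succ'
      (fun k => gaussBinom q n k * (q ^ (∑ i ∈ Finset.range k, i) * x ^ k)) (n + 1)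
    rw [Finset.sum_range_succ, gaussBinom_of_lt (Nat.lt_succ_self n), zero_mul, add_zero] at h2
    simp only [gaussBinom_zero hq] at h2 ⊢
    rw [h1]
    linear_combination h2

/-- The summand `q ^ (n (n - 1) / 2) z ^ n` of the theta series, with `q = e^σ` and `z = e^ζ`. -/
def thetaTerm (σ ζ : ℂ) (n : ℤ) : ℂ := Complex.exp (σ * ((n : ℂ) * (n - 1) / 2) + ζ * n)

lemma summable_thetaTerm {σ : ℂ} (hσ : σ.re < 0) (ζ : ℂ) : Summable (thetaTerm σ ζ) := by
  have hπ := Complex.two_pi_I_ne_zero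
  have h1 : 0 < (σ / (2 * Real.pi * Complex.I)).im := by
    have : σ / (2 * Real.pi * Complex.I) = (((2 * Real.pi)⁻¹ : ℝ) : ℂ) * (-(Complex.I * σ)) := by
      rw [div_eq_iff hπ]
      push_cast
      have : (Real.pi : ℂ) ≠ 0 := by exact_mod_cast Real.pi_ne_zero
      field_simp
      rw [Complex.I_sq]
      ring
    rw [this, Complex.im_ofReal_mul]
    have : 0 < (2 * Real.pi)⁻¹ := by positivity
    refine mul_pos this ?_
    simp only [Complex.neg_im, Complex.mul_im, Complex.I_re, Complex.I_im, zero_mul, one_mul]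
    linarith
  refine ((summable_jacobiTheta₂_term_iff ((ζ - σ / 2) / (2 * Real.pi * Complex.I)) _).mpr h1).congr
    fun n => ?_
  rw [jacobiTheta₂_term, thetaTerm]
  congr 1
  have : (Real.pi : ℂ) ≠ 0 := by exact_mod_cast Real.pi_ne_zero
  have := Complex.I_ne_zero
  field_simp
  ring

lemma exp_norm_lt_one {σ : ℂ} (hσ : σ.re < 0) : ‖Complex.exp σ‖ < 1 := by
  rw [Complex.norm_exp, Real.exp_lt_one_iff]
  exact hσ

/-- The finite form of the Jacobi triple product. -/
lemma finite_triple_product {σ : ℂ} (hσ : σ.re < 0) (ζ : ℂ) (N : ℕ) :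
    ∏ j ∈ Finset.range N, ((1 + Complex.exp (ζ + σ * j)) * (1 + Complex.exp (-ζ + σ * (j + 1))))
      = ∑ k ∈ Finset.range (2 * N + 1),
          gaussBinom (Complex.exp σ) (2 * N) k * thetaTerm σ ζ ((k : ℤ) - N) := by
  have h1 := prod_one_add_mul_pow (exp_norm_lt_one hσ) (Complex.exp (ζ - σ * N)) (2 * N)
  have hsum : ∀ k : ℕ, ((∑ i ∈ Finset.range k, i : ℕ) : ℂ) = (k : ℂ) * (k - 1) / 2 := by
    intro k
    induction k with
    | zero => simp
    | succ k ih => rw [Finset.sum_range_succ, Nat.cast_add, ih]; push_cast; ring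
  have h2 : ∏ j ∈ Finset.range (2 * N), (1 + Complex.exp (ζ - σ * N) * Complex.exp σ ^ j)
      = Complex.exp (N * ζ - σ * (N * (N + 1) / 2)) * ∏ j ∈ Finset.range N,
        ((1 + Complex.exp (ζ + σ * j)) * (1 + Complex.exp (-ζ + σ * (j + 1)))) := by
    have h3 : Complex.exp (N * ζ - σ * (N * (N + 1) / 2))
        = ∏ j ∈ Finset.range N, Complex.exp (ζ - σ * (j + 1)) := by
      rw [← Complex.exp_sum]
      congr 1
      rw [Finset.sum_sub_distrib, ← Finset.mul_sum, Finset.sum_add_distrib, ← Nat.cast_sum, hsum]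
      simp only [Finset.sum_const, Finset.card_range, nsmul_eq_mul]
      ring
    have h4 : ∏ j ∈ Finset.range N, (1 + Complex.exp (ζ - σ * N) * Complex.exp σ ^ j)
        = Complex.exp (N * ζ - σ * (N * (N + 1) / 2))
          * ∏ j ∈ Finset.range N, (1 + Complex.exp (-ζ + σ * (j + 1))) := by
      rw [h3, ← Finset.prod_mul_distrib, ← Finset.prod_range_reflect _ N]
      refine Finset.prod_congr rfl fun j hj => ?_
      have hj := Finset.mem_range.mp hj
      have h5 : ((N - 1 - j : ℕ) : ℂ) = N - 1 - j := by
        rw [Nat.cast_sub (by omega), Nat.cast_sub (by omega), Nat.cast_one]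
      rw [← Complex.exp_nat_mul, ← Complex.exp_add, mul_add, ← Complex.exp_add, mul_one, h5,
        show ζ - σ * (j + 1) + (-ζ + σ * (j + 1)) = 0 by ring, Complex.exp_zero, add_comm]
      congr 2
      ring
    rw [two_mul, Finset.prod_range_add, h4, mul_assoc, Finset.prod_mul_distrib,
      mul_comm (∏ j ∈ Finset.range N, (1 + Complex.exp (ζ + σ * j)))]
    congr 2
    refine Finset.prod_congr rfl fun j _ => ?_
    rw [← Complex.exp_nat_mul, ← Complex.exp_add]
    congr 2
    push_cast
    ring
  rw [h2] at h1
  refine mul_left_cancel₀ (Complex.exp_ne_zero (N * ζ - σ * (N * (N + 1) / 2))) (h1.trans ?_)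
  rw [Finset.mul_sum]
  refine Finset.sum_congr rfl fun k _ => ?_
  rw [mul_left_comm (Complex.exp (N * ζ - σ * (N * (N + 1) / 2))), thetaTerm,
    ← Complex.exp_nat_mul, ← Complex.exp_nat_mul, ← Complex.exp_add, ← Complex.exp_add, hsum]
  congr 2
  push_cast
  ring

lemma tendsto_qFactor (hq : ‖q‖ < 1) : Tendsto (qFactor q) atTop (𝓝 (eulerProd q)) :=
  (ModularForm.multipliable_one_sub_pow hq).hasProd.tendsto_prod_nat

lemma eulerProd_ne_zero (hq : ‖q‖ < 1) : eulerProd q ≠ 0 := by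
  have := tprod_one_add_ne_zero_of_summable (f := fun n : ℕ => -q ^ (n + 1)) (fun n => by
    rw [← sub_eq_add_neg]; exact one_sub_pow_ne_zero hq n) (by
    simp only [norm_neg, norm_pow]
    exact (summable_nat_add_iff 1).mpr (summable_geometric_of_lt_one (norm_nonneg _) hq))
  simpa only [← sub_eq_add_neg, eulerProd] using this

/-- The Jacobi triple product, as a limit of partial products. -/
lemma tendsto_triple_product {σ : ℂ} (hσ : σ.re < 0) (ζ : ℂ) :
    Tendsto (fun N : ℕ => ∏ j ∈ Finset.range N,
        ((1 + Complex.exp (ζ + σ * j)) * (1 + Complex.exp (-ζ + σ * (j + 1))))) atTop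
      (𝓝 ((eulerProd (Complex.exp σ))⁻¹ * ∑' n, thetaTerm σ ζ n)) := by
  set q := Complex.exp σ with hq
  have hq1 : ‖q‖ < 1 := exp_norm_lt_one hσ
  have hQ := tendsto_qFactor hq1
  have hQ0 := eulerProd_ne_zero hq1
  -- the finite sums, extended by zero to all integers
  set G : ℕ → ℤ → ℂ := fun N n => if -(N : ℤ) ≤ n then gaussBinom q (2 * N) (n + N).toNat else 0
    with hG
  have hfin : ∀ N : ℕ, ∏ j ∈ Finset.range N,
      ((1 + Complex.exp (ζ + σ * j)) * (1 + Complex.exp (-ζ + σ * (j + 1))))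
      = ∑' n, G N n * thetaTerm σ ζ n := by
    intro N
    have hinj : Function.Injective fun k : ℕ => (k : ℤ) - N := fun a b h => by
      have : (a : ℤ) - N = b - N := h
      omega
    rw [finite_triple_product hσ, tsum_eq_sum (s := (Finset.range (2 * N + 1)).map ⟨_, hinj⟩),
      Finset.sum_map]
    · refine Finset.sum_congr rfl fun k _ => ?_
      simp only [hG, Function.Embedding.coeFn_mk]
      rw [if_pos (by omega), sub_add_cancel, Int.toNat_natCast]
    · intro n hn
      simp only [hG]
      split_ifs with h
      · rw [gaussBinom_of_lt, zero_mul]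
        by_contra hcon
        refine hn (Finset.mem_map.mpr ⟨(n + N).toNat, Finset.mem_range.mpr (by omega), ?_⟩)
        simp only [Function.Embedding.coeFn_mk]
        omega
      · rw [zero_mul]
  rw [tendsto_congr hfin, ← tsum_mul_left]
  have hqF := qFactor_ne_zero hq1
  obtain ⟨B, hB⟩ := hQ.norm.bddAbove_range
  obtain ⟨B', hB'⟩ := (hQ.inv₀ hQ0).norm.bddAbove_range
  have hB : ∀ n, ‖qFactor q n‖ ≤ B := fun n => hB ⟨n, rfl⟩
  have hB' : ∀ n, ‖(qFactor q n)⁻¹‖ ≤ B' := fun n => hB' ⟨n, rfl⟩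
  have hB0 : 0 ≤ B := (norm_nonneg _).trans (hB 0)
  have hB0' : 0 ≤ B' := (norm_nonneg _).trans (hB' 0)
  refine tendsto_tsum_of_dominated_convergence
    (bound := fun n => B * (B' * B') * ‖thetaTerm σ ζ n‖)
    ((summable_thetaTerm hσ ζ).norm.mul_left _) (fun n => ?_) (Eventually.of_forall fun N n => ?_)
  · refine Tendsto.mul_const _ ?_
    have hev : ∀ᶠ N : ℕ in atTop, G N n = qFactor q (2 * N)
        / (qFactor q (n + N).toNat * qFactor q ((-n) + N).toNat) := by
      filter_upwards [eventually_ge_atTop n.natAbs] with N hN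
      simp only [hG]
      rw [if_pos (by omega), gaussBinom, if_pos (by omega),
        show 2 * N - (n + N).toNat = ((-n) + N).toNat by omega]
    rw [tendsto_congr' hev]
    have hto : ∀ m : ℤ, Tendsto (fun N : ℕ => (m + N).toNat) atTop atTop := fun m =>
      tendsto_atTop.mpr fun b => by
        filter_upwards [eventually_ge_atTop (b + m.natAbs)] with N hN
        omega
    have h2N : Tendsto (fun N : ℕ => 2 * N) atTop atTop :=
      tendsto_atTop.mpr fun b => by
        filter_upwards [eventually_ge_atTop b] with N hN
        omega
    have h := (hQ.comp h2N).div ((hQ.comp (hto n)).mul (hQ.comp (hto (-n)))) (mul_ne_zero hQ0 hQ0)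
    rwa [div_mul_cancel_left₀ hQ0] at h
  · rw [norm_mul]
    refine mul_le_mul_of_nonneg_right ?_ (norm_nonneg _)
    have hpos : 0 ≤ B * (B' * B') := by positivity
    simp only [hG]
    split_ifs with h
    · rw [gaussBinom]
      split_ifs with h'
      · rw [div_eq_mul_inv, mul_inv, norm_mul, norm_mul]
        gcongr
        exacts [hB _, hB' _, hB' _]
      · rwa [norm_zero]
    · rwa [norm_zero]

/-- The theta series at `ζ = 0` does not vanish, since no factor of its product expansion does. -/
lemma tsum_thetaTerm_zero_ne_zero {σ : ℂ} (hσ : σ.re < 0) : ∑' n, thetaTerm σ 0 n ≠ 0 := by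
  set q := Complex.exp σ with hq
  have hq1 : ‖q‖ < 1 := exp_norm_lt_one hσ
  have hne : ∀ n : ℕ, 1 + q ^ n ≠ 0 := by
    intro n h
    rcases n with _ | n
    · rw [pow_zero] at h
      norm_num at h
    · have h1 : ‖q ^ (n + 1)‖ < 1 := by
        rw [norm_pow]
        exact pow_lt_one₀ (norm_nonneg _) hq1 (Nat.succ_ne_zero n)
      rw [← neg_eq_of_add_eq_zero_right h, norm_neg, norm_one] at h1
      exact h1.false
  have hs : Summable fun n : ℕ => ‖q ^ n‖ := by
    simp only [norm_pow]
    exact summable_geometric_of_lt_one (norm_nonneg _) hq1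
  have hs' : Summable fun n : ℕ => ‖q ^ (n + 1)‖ := (summable_nat_add_iff 1).mpr hs
  have h1 := (multipliable_one_add_of_summable hs).hasProd.tendsto_prod_nat
  have h2 := (multipliable_one_add_of_summable hs').hasProd.tendsto_prod_nat
  have h3 := h1.mul h2
  have h4 := tendsto_nhds_unique (tendsto_triple_product hσ 0) (h3.congr fun N => by
    rw [← Finset.prod_mul_distrib]
    refine Finset.prod_congr rfl fun j _ => ?_
    rw [hq, ← Complex.exp_nat_mul, ← Complex.exp_nat_mul]
    congr 3 <;> push_cast <;> ring)
  intro h0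
  rw [h0, mul_zero] at h4
  exact mul_ne_zero (tprod_one_add_ne_zero_of_summable hne hs)
    (tprod_one_add_ne_zero_of_summable (fun n => hne (n + 1)) hs') h4.symm

/-- The `l`-fold multiplication formula: with `p = e^σ`, the theta functions of nome `p ^ l` at the
arguments shifted by the powers of `p` multiply to the theta function of nome `p`, because their
product expansions together contain every factor of its expansion once. -/
lemma prod_tsum_thetaTerm {σ : ℂ} (hσ : σ.re < 0) (ζ : ℂ) {l : ℕ} (hl : 0 < l) :
    ∏ j : Fin l, ∑' n, thetaTerm (l * σ) (ζ + σ * (j : ℕ)) n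
      = eulerProd (Complex.exp (l * σ)) ^ l / eulerProd (Complex.exp σ)
        * ∑' n, thetaTerm σ ζ n := by
  have hlσ : ((l : ℂ) * σ).re < 0 := by
    rw [← Complex.ofReal_natCast, Complex.re_ofReal_mul]
    exact mul_neg_of_pos_of_neg (by exact_mod_cast hl) hσ
  have h1 : Tendsto (fun N : ℕ => ∏ j ∈ Finset.range l, ∏ m ∈ Finset.range N,
      ((1 + Complex.exp ((ζ + σ * j) + l * σ * m))
        * (1 + Complex.exp (-(ζ + σ * j) + l * σ * (m + 1))))) atTop
      (𝓝 (∏ j ∈ Finset.range l, ((eulerProd (Complex.exp (l * σ)))⁻¹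
        * ∑' n, thetaTerm (l * σ) (ζ + σ * j) n))) :=
    tendsto_finsetProd _ fun j _ => tendsto_triple_product hlσ (ζ + σ * j)
  have h2 : Tendsto (fun N : ℕ => l * N) atTop atTop :=
    tendsto_atTop.mpr fun b => by
      filter_upwards [eventually_ge_atTop b] with N hN
      nlinarith
  have h3 := (tendsto_triple_product hσ ζ).comp h2
  have h4 : ∀ N : ℕ, ∏ j ∈ Finset.range (l * N),
        ((1 + Complex.exp (ζ + σ * j)) * (1 + Complex.exp (-ζ + σ * (j + 1))))
      = ∏ j ∈ Finset.range l, ∏ m ∈ Finset.range N,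
        ((1 + Complex.exp ((ζ + σ * j) + l * σ * m))
          * (1 + Complex.exp (-(ζ + σ * j) + l * σ * (m + 1)))) := by
    intro N
    induction N with
    | zero => simp
    | succ N ih =>
      simp only [Finset.prod_range_succ _ N]
      rw [Nat.mul_succ, Finset.prod_range_add, ih]
      refine Eq.trans ?_ Finset.prod_mul_distrib.symm
      congr 1
      rw [Finset.prod_mul_distrib, Finset.prod_mul_distrib]
      congr 1
      · refine Finset.prod_congr rfl fun j _ => ?_
        congr 2
        push_cast
        ring
      -- the factors `1 + z⁻¹ p ^ (l m + l - j)` occur in reverse order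
      · rw [← Finset.prod_range_reflect _ l]
        refine Finset.prod_congr rfl fun j hj => ?_
        have hj := Finset.mem_range.mp hj
        have h5 : ((l * N + (l - 1 - j) : ℕ) : ℂ) = l * N + (l - 1 - j) := by
          rw [Nat.cast_add, Nat.cast_mul, Nat.cast_sub (by omega), Nat.cast_sub (by omega),
            Nat.cast_one]
        rw [h5]
        congr 2
        ring
  have h5 := tendsto_nhds_unique h1 (h3.congr h4)
  rw [Finset.prod_mul_distrib, Finset.prod_const, Finset.card_range,
    Finset.prod_range fun j => ∑' n, thetaTerm (l * σ) (ζ + σ * (j : ℕ)) n] at h5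
  have h6 := eulerProd_ne_zero (exp_norm_lt_one hlσ)
  have h7 := eulerProd_ne_zero (exp_norm_lt_one hσ)
  rw [inv_pow, inv_mul_eq_iff_eq_mul₀ (pow_ne_zero _ h6)] at h5
  rw [h5]
  ring

end TripleProduct

/-! ### Sums over hyperplanes -/

section CyclicShift

/-- The summand of the product of `l` theta functions. -/
def cyclicTerm (σ : ℂ) {l : ℕ} (k : Fin l → ℤ) : ℂ :=
  ∏ j : Fin l, thetaTerm (l * σ) (σ * (j : ℕ)) (k j)

/-- The sum of the summands of the product of `l` theta functions over a hyperplane `∑ k = n`. -/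
def cyclicSum (σ : ℂ) (l : ℕ) (n : ℤ) : ℂ :=
  ∑' k : {k : Fin l → ℤ // ∑ j, k j = n}, cyclicTerm σ k.1

/-- The cyclic shift of the coordinates that raises one of them by one. -/
def cyclicShift (l : ℕ) (n : ℤ) :
    {k : Fin (l + 1) → ℤ // ∑ j, k j = n} ≃ {k : Fin (l + 1) → ℤ // ∑ j, k j = n + 1} where
  toFun k := ⟨Fin.cons (k.1 (Fin.last l) + 1) (Fin.init k.1), by
    rw [Fin.sum_univ_succ, Fin.cons_zero]
    simp only [Fin.cons_succ, Fin.init]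
    have := k.2
    rw [Fin.sum_univ_castSucc] at this
    omega⟩
  invFun k := ⟨Fin.snoc (Fin.tail k.1) (k.1 0 - 1), by
    have := k.2
    rw [Fin.sum_univ_succ] at this
    simp only [Fin.sum_univ_castSucc, Fin.snoc_castSucc, Fin.snoc_last, Fin.tail]
    omega⟩
  left_inv k := Subtype.ext (by simp)
  right_inv k := Subtype.ext (by simp)

lemma cyclicTerm_cyclicShift (σ : ℂ) {l : ℕ} {n : ℤ}
    (k : {k : Fin (l + 1) → ℤ // ∑ j, k j = n}) :
    cyclicTerm σ (cyclicShift l n k).1 = Complex.exp (σ * n) * cyclicTerm σ k.1 := by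
  obtain ⟨k, rfl⟩ := k
  simp only [cyclicTerm, cyclicShift, Equiv.coe_fn_mk, thetaTerm]
  rw [← Complex.exp_sum, ← Complex.exp_sum, ← Complex.exp_add]
  congr 1
  have h : ∑ i : Fin l, (((l + 1 : ℕ) : ℂ) * σ * ((k i.castSucc : ℂ) * (k i.castSucc - 1) / 2)
        + σ * ((i + 1 : ℕ) : ℂ) * k i.castSucc)
      = ∑ i : Fin l, σ * (k i.castSucc : ℂ)
        + ∑ i : Fin l, (((l + 1 : ℕ) : ℂ) * σ * ((k i.castSucc : ℂ) * (k i.castSucc - 1) / 2)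
          + σ * ((i : ℕ) : ℂ) * k i.castSucc) := by
    rw [← Finset.sum_add_distrib]
    refine Finset.sum_congr rfl fun i _ => ?_
    push_cast
    ring
  rw [Fin.sum_univ_succ, Fin.sum_univ_castSucc (n := l), Fin.sum_univ_castSucc (n := l)]
  simp only [Fin.cons_zero, Fin.cons_succ, Fin.init, Fin.val_succ, Fin.val_zero, Fin.val_castSucc,
    Fin.val_last]
  rw [h, ← Finset.mul_sum]
  push_cast
  ring

lemma cyclicSum_succ (σ : ℂ) {l : ℕ} (hl : 0 < l) (n : ℤ) :
    cyclicSum σ l (n + 1) = Complex.exp (σ * n) * cyclicSum σ l n := by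
  obtain ⟨l, rfl⟩ := Nat.exists_eq_succ_of_ne_zero hl.ne'
  rw [cyclicSum, cyclicSum, ← tsum_mul_left, ← (cyclicShift l n).tsum_eq]
  exact tsum_congr fun k => cyclicTerm_cyclicShift σ k

lemma cyclicSum_eq (σ : ℂ) {l : ℕ} (hl : 0 < l) (n : ℤ) :
    cyclicSum σ l n = cyclicSum σ l 0 * thetaTerm σ 0 n := by
  have hstep : ∀ n : ℤ, thetaTerm σ 0 (n + 1) = Complex.exp (σ * n) * thetaTerm σ 0 n := by
    intro n
    rw [thetaTerm, thetaTerm, ← Complex.exp_add]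
    congr 1
    push_cast
    ring
  induction n using Int.induction_on with
  | zero => simp [thetaTerm]
  | succ n ih => rw [cyclicSum_succ σ hl, ih, hstep]; ring
  | pred n ih =>
    have h1 := cyclicSum_succ σ hl (-(n : ℤ) - 1)
    have h2 := hstep (-(n : ℤ) - 1)
    rw [sub_add_cancel] at h1 h2
    rw [ih, h2, mul_left_comm] at h1
    exact (mul_left_cancel₀ (Complex.exp_ne_zero _) h1).symm

lemma natCast_mul_re_neg {σ : ℂ} (hσ : σ.re < 0) {l : ℕ} (hl : 0 < l) : ((l : ℂ) * σ).re < 0 := by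
  rw [← Complex.ofReal_natCast, Complex.re_ofReal_mul]
  exact mul_neg_of_pos_of_neg (by exact_mod_cast hl) hσ

lemma summable_norm_cyclicTerm {σ : ℂ} (hσ : σ.re < 0) {l : ℕ} (hl : 0 < l) :
    Summable fun k : Fin l → ℤ => ‖cyclicTerm σ k‖ :=
  summable_norm_pi_prod (f := fun j : Fin l => thetaTerm (l * σ) (σ * (j : ℕ)))
    fun _ => (summable_thetaTerm (natCast_mul_re_neg hσ hl) _).norm

/-- The sum over the hyperplane `∑ k = 0`, found by summing over all hyperplanes: the sums are
proportional to the terms of one theta function, and add up to the product of `l` others. -/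
lemma cyclicSum_zero {σ : ℂ} (hσ : σ.re < 0) {l : ℕ} (hl : 0 < l) :
    cyclicSum σ l 0 = eulerProd (Complex.exp (l * σ)) ^ l / eulerProd (Complex.exp σ) := by
  have h1 := prod_tsum_thetaTerm hσ 0 hl
  simp only [zero_add] at h1
  have hs := summable_norm_cyclicTerm hσ hl
  have h2 : ∏ j : Fin l, ∑' n, thetaTerm (l * σ) (σ * (j : ℕ)) n
      = ∑' k : Fin l → ℤ, cyclicTerm σ k :=
    (tsum_pi_prod (f := fun j : Fin l => thetaTerm (l * σ) (σ * (j : ℕ)))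
      fun _ => (summable_thetaTerm (natCast_mul_re_neg hσ hl) _).norm).symm
  have h3 : ∑' k : Fin l → ℤ, cyclicTerm σ k = ∑' n, cyclicSum σ l n := by
    let E := Equiv.sigmaFiberEquiv fun k : Fin l → ℤ => ∑ j, k j
    rw [← E.tsum_eq]
    exact (E.summable_iff.mpr hs.of_norm).tsum_sigma
  rw [h2, h3, tsum_congr fun n => cyclicSum_eq σ hl n, tsum_mul_left] at h1
  exact mul_right_cancel₀ (tsum_thetaTerm_zero_ne_zero hσ) h1

end CyclicShift

/-! ### The theta function identity -/

section Identity

lemma eta_eq (τ : ℂ) : ModularForm.eta τ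
    = Complex.exp (2 * Real.pi * Complex.I * τ / 24)
      * eulerProd (Complex.exp (2 * Real.pi * Complex.I * τ)) := by
  rw [ModularForm.eta, eulerProd, Function.Periodic.qParam]
  congr 1
  exact tprod_congr fun n => by rw [ModularForm.eta_q_eq_pow]

lemma two_pi_I_mul_re_neg {τ : ℂ} (hτ : 0 < τ.im) : (2 * Real.pi * Complex.I * τ).re < 0 := by
  simp only [Complex.mul_re, Complex.mul_im, Complex.I_re, Complex.I_im, Complex.ofReal_re,
    Complex.ofReal_im, Complex.re_ofNat, Complex.im_ofNat]
  nlinarith [mul_pos Real.pi_pos hτ]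

lemma summable_gauss {τ : ℂ} (hτ : 0 < τ.im) {m : ℕ} (hm : 0 < m) (x : ℂ) :
    Summable fun n : ℤ =>
      ‖Complex.exp (2 * Real.pi * Complex.I * τ * ((x + n) ^ 2 / (2 * (m : ℂ))))‖ := by
  have hσ : (2 * Real.pi * Complex.I * τ / m).re < 0 := by
    rw [Complex.div_natCast_re]
    exact div_neg_of_neg_of_pos (two_pi_I_mul_re_neg hτ) (by exact_mod_cast hm)
  have hm' : (m : ℂ) ≠ 0 := by exact_mod_cast hm.ne'
  have h := ((summable_thetaTerm hσ (2 * Real.pi * Complex.I * τ / m * (x + 1 / 2))).mul_left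
    (Complex.exp (2 * Real.pi * Complex.I * τ * (x ^ 2 / (2 * m))))).norm
  refine h.congr fun n => ?_
  rw [thetaTerm, ← Complex.exp_add]
  congr 2
  field_simp
  ring

lemma gaussTerm_eq_prod {κ : Type} [Fintype κ] (τ : ℂ) (m : κ → ℕ) (x : κ → ℂ) :
    gaussTerm τ m x
      = ∏ i, Complex.exp (2 * Real.pi * Complex.I * τ * (x i ^ 2 / (2 * (m i : ℂ)))) := by
  rw [gaussTerm, Finset.mul_sum, Complex.exp_sum]

lemma summable_norm_gaussTerm {κ : Type} [Fintype κ] {τ : ℂ} (hτ : 0 < τ.im) {m : κ → ℕ}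
    (hm : ∀ i, 0 < m i) (x : κ → ℂ) :
    Summable fun k : κ → ℤ => ‖gaussTerm τ m fun i => x i + k i‖ := by
  simp only [gaussTerm_eq_prod]
  exact summable_norm_pi_prod (f := fun i (n : ℤ) =>
    Complex.exp (2 * Real.pi * Complex.I * τ * ((x i + n) ^ 2 / (2 * (m i : ℂ)))))
    fun i => summable_gauss hτ (hm i) (x i)

/-- The shifts `r + (1 - l + 2 j) / (2 l)` of a cycle of length `l`. -/
abbrev cycleShift (l : ℕ) (r : ℂ) (j : Fin l) : ℂ :=
  r + (1 - (l : ℂ) + 2 * ((j : ℕ) : ℂ)) / (2 * (l : ℂ))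

lemma sum_arith_sq (a b : ℂ) (m : ℕ) : ∑ j ∈ Finset.range m, (a + b * j) ^ 2
    = m * a ^ 2 + a * b * (m * (m - 1)) + b ^ 2 * (m * (m - 1) * (2 * m - 1) / 6) := by
  induction m with
  | zero => simp
  | succ m ih => rw [Finset.sum_range_succ, ih]; push_cast; ring

/-- The theta function of a single cycle of length `l`, restricted to a hyperplane. -/
lemma tsum_gaussTerm_cycle {τ : ℂ} (hτ : 0 < τ.im) {l : ℕ} (hl : 0 < l) (r : ℂ) (n : ℤ) :
    ∑' k : {k : Fin l → ℤ // ∑ j, k j = n}, gaussTerm τ (fun _ => 1)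
        (fun j => cycleShift l r j + (k.1 j : ℂ))
      = ModularForm.eta τ ^ l / ModularForm.eta (τ / l)
        * Complex.exp (2 * Real.pi * Complex.I * τ * ((l * r + n) ^ 2 / (2 * (l : ℂ)))) := by
  have hl' : (l : ℂ) ≠ 0 := by exact_mod_cast hl.ne'
  set σ := 2 * Real.pi * Complex.I * τ / l with hσ
  have hσl : l * σ = 2 * Real.pi * Complex.I * τ := by rw [hσ]; field_simp
  have hσ' : 2 * Real.pi * Complex.I * (τ / l) = σ := by rw [hσ]; ring
  have hσ0 : σ.re < 0 := by
    rw [hσ, Complex.div_natCast_re]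
    exact div_neg_of_neg_of_pos (two_pi_I_mul_re_neg hτ) (by exact_mod_cast hl)
  have hterm : ∀ k : {k : Fin l → ℤ // ∑ j, k j = n},
      gaussTerm τ (fun _ => 1) (fun j => cycleShift l r j + (k.1 j : ℂ))
      = Complex.exp (σ * (l ^ 2 * r ^ 2 / 2 + (l ^ 2 - 1) / 24 + n * (l * r + 1 / 2)))
        * cyclicTerm σ k.1 := by
    rintro ⟨k, rfl⟩
    simp only [cyclicTerm, thetaTerm, gaussTerm]
    rw [← Complex.exp_sum, ← Complex.exp_add, ← hσl]
    congr 1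
    have h1 : (∑ j : Fin l, (cycleShift l r j) ^ 2) = l * r ^ 2 + (l ^ 2 - 1) / (12 * l) := by
      have h2 := sum_arith_sq (r + (1 - l) / (2 * l)) (1 / l) l
      rw [Finset.sum_range] at h2
      refine Eq.trans (Finset.sum_congr rfl fun j _ => ?_) (h2.trans ?_)
      · rw [cycleShift]
        congr 1
        field_simp
        ring
      · field_simp
        ring
    have h3 : σ * (l ^ 2 * r ^ 2 / 2 + (l ^ 2 - 1) / 24)
        = ∑ j : Fin l, l * σ * ((cycleShift l r j) ^ 2 / 2) := by
      rw [← Finset.mul_sum, ← Finset.sum_div, h1]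
      field_simp
      ring
    rw [mul_add σ, h3]
    push_cast
    rw [Finset.sum_mul, Finset.mul_sum, Finset.mul_sum, ← Finset.sum_add_distrib,
      ← Finset.sum_add_distrib]
    refine Finset.sum_congr rfl fun j _ => ?_
    rw [cycleShift]
    field_simp
    ring
  have hη : eulerProd (Complex.exp σ) ≠ 0 := eulerProd_ne_zero (exp_norm_lt_one hσ0)
  rw [tsum_congr hterm, tsum_mul_left]
  change _ * cyclicSum σ l n = _
  rw [cyclicSum_eq σ hl, cyclicSum_zero hσ0 hl, eta_eq, eta_eq, hσ', ← hσl, mul_pow,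
    ← Complex.exp_nat_mul, thetaTerm]
  have hexp : Complex.exp (σ * (l ^ 2 * r ^ 2 / 2 + (l ^ 2 - 1) / 24 + n * (l * r + 1 / 2)))
      * Complex.exp (σ * ((n : ℂ) * (n - 1) / 2) + 0 * n)
      = Complex.exp (l * (l * σ / 24)) / Complex.exp (σ / 24)
        * Complex.exp (l * σ * ((l * r + n) ^ 2 / (2 * (l : ℂ)))) := by
    rw [← Complex.exp_sub, ← Complex.exp_add, ← Complex.exp_add]
    congr 1
    field_simp
    ring
  rw [mul_div_mul_comm]
  linear_combination (eulerProd (Complex.exp (l * σ)) ^ l / eulerProd (Complex.exp σ)) * hexp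

/-- An integer vector of total `0` on a union of cycles is a family of vectors on the cycles whose
totals add up to `0`. -/
def cycleDecomposition {K : ℕ} (l : Fin K → ℕ) :
    (Σ n : {n : Fin K → ℤ // ∑ i, n i = 0}, ∀ i, {k : Fin (l i) → ℤ // ∑ j, k j = n.1 i})
      ≃ {k : (Σ i, Fin (l i)) → ℤ // ∑ s, k s = 0} where
  toFun x := ⟨fun s => (x.2 s.1).1 s.2, by
    rw [Fintype.sum_sigma]
    refine Eq.trans ?_ x.1.2
    exact Finset.sum_congr rfl fun i _ => (x.2 i).2⟩
  invFun k := ⟨⟨fun i => ∑ j, k.1 ⟨i, j⟩, by rw [← Fintype.sum_sigma]; exact k.2⟩,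
    fun i => ⟨fun j => k.1 ⟨i, j⟩, rfl⟩⟩
  left_inv := by
    rintro ⟨⟨n, hn⟩, x⟩
    obtain ⟨y, hy, rfl⟩ : ∃ (y : ∀ i, Fin (l i) → ℤ) (hy : ∀ i, ∑ j, y i j = n i),
      x = fun i => ⟨y i, hy i⟩ := ⟨fun i => (x i).1, fun i => (x i).2, rfl⟩
    obtain rfl : n = fun i => ∑ j, y i j := funext fun i => (hy i).symm
    rfl
  right_inv k := rfl

lemma thetaA_cycles {K : ℕ} (l : Fin K → ℕ) (r : Fin K → ℂ) {τ : ℂ} (hl : ∀ i, 0 < l i)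
    (hτ : 0 < τ.im) :
    thetaA τ (fun _ => 1) (fun s : (Σ i, Fin (l i)) => cycleShift (l s.1) (r s.1) s.2)
      = (∏ i, ModularForm.eta τ ^ l i / ModularForm.eta (τ / l i))
        * thetaA τ l fun i => (l i : ℂ) * r i := by
  have hs := summable_norm_gaussTerm hτ (m := fun _ => 1) (fun _ => one_pos)
    fun s : (Σ i, Fin (l i)) => cycleShift (l s.1) (r s.1) s.2
  have hs' := (cycleDecomposition l).summable_iff.mpr
    (hs.of_norm.subtype {k | ∑ s, k s = 0})
  rw [thetaA, thetaA, ← (cycleDecomposition l).tsum_eq, ← tsum_mul_left]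
  refine hs'.tsum_sigma.trans ?_
  refine tsum_congr fun n => ?_
  rw [gaussTerm_eq_prod, ← Finset.prod_mul_distrib, ← Finset.prod_congr rfl fun i _ =>
    tsum_gaussTerm_cycle hτ (hl i) (r i) (n.1 i), ← tsum_pi_prod]
  · refine tsum_congr fun k => ?_
    simp only [gaussTerm_eq_prod]
    exact Fintype.prod_sigma _
  · exact fun i => (summable_norm_gaussTerm hτ (fun _ => one_pos) _).subtype
      {k | ∑ j, k j = n.1 i}

end Identity

end TwistFields

end

theorem mainTheorem2 :
    (∀ (N : ℕ) (a b : TwistFields.DotGL N), a.Conj b →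
      TwistFields.HasCharacter a.L0 a.module ∧ TwistFields.HasCharacter b.L0 b.module ∧
      ∀ τ : ℂ, 0 < τ.im → a.chi τ = b.chi τ) ∧
    (∀ (N : ℕ) (a b : TwistFields.DotD N), a.Conj b →
      TwistFields.HasCharacter a.L0 a.module ∧ TwistFields.HasCharacter b.L0 b.module ∧
      ∀ τ : ℂ, 0 < τ.im → a.chi τ = b.chi τ) ∧
    (∀ (N : ℕ) (a b : TwistFields.DotB N), a.Conj b →
      (TwistFields.HasCharacter a.L0 ⊤ ∧ TwistFields.HasCharacter b.L0 ⊤ ∧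
        ∀ ε : ZMod 2, TwistFields.HasCharacter a.L0 (a.part ε) ∧
          TwistFields.HasCharacter b.L0 (b.part ε)) ∧
      ∀ τ : ℂ, 0 < τ.im → a.chiPlus τ = b.chiPlus τ ∧ a.chiMinus τ = b.chiMinus τ) ∧
    (∀ (K : ℕ) (l : Fin K → ℕ) (r : Fin K → ℂ) (τ : ℂ), (∀ i, 0 < l i) → 0 < τ.im →
      (Summable fun k : {k : (Σ i, Fin (l i)) → ℤ // ∑ s, k s = 0} =>
        TwistFields.gaussTerm τ (fun _ => 1) (fun s =>
          r s.1 + (1 - (l s.1 : ℂ) + 2 * ((s.2 : ℕ) : ℂ)) / (2 * (l s.1 : ℂ)) + (k.1 s : ℂ))) ∧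
      (Summable fun n : {n : Fin K → ℤ // ∑ i, n i = 0} =>
        TwistFields.gaussTerm τ l (fun i => (l i : ℂ) * r i + (n.1 i : ℂ))) ∧
      TwistFields.thetaA τ (fun _ => 1) (fun s : (Σ i, Fin (l i)) =>
          r s.1 + (1 - (l s.1 : ℂ) + 2 * ((s.2 : ℕ) : ℂ)) / (2 * (l s.1 : ℂ)))
          / ModularForm.eta τ ^ (∑ i, l i)
        = TwistFields.thetaA τ l (fun i => (l i : ℂ) * r i)
          / ∏ i, ModularForm.eta (τ / (l i : ℂ))) := by
  refine ⟨fun N a b h => ⟨a.hasCharacter, b.hasCharacter, fun τ _ => TwistFields.DotGL.chi_eq h τ⟩,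
    fun N a b h => ⟨a.hasCharacter, b.hasCharacter, fun τ _ => TwistFields.DotD.chi_eq h τ⟩,
    fun N a b h => ⟨⟨a.hasCharacter_top, b.hasCharacter_top,
      fun ε => ⟨a.hasCharacter_part ε, b.hasCharacter_part ε⟩⟩,
      fun τ _ => TwistFields.DotB.chi_eq h τ⟩,
    fun K l r τ hl hτ => ⟨?_, ?_, ?_⟩⟩
  · exact (TwistFields.summable_norm_gaussTerm hτ (fun _ => one_pos) _).of_norm.subtype
      {k | ∑ s, k s = 0}
  · exact (TwistFields.summable_norm_gaussTerm hτ hl _).of_norm.subtype {n | ∑ i, n i = 0}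
  · have hη : ModularForm.eta τ ≠ 0 := ModularForm.eta_ne_zero hτ
    have h := TwistFields.thetaA_cycles l r hl hτ
    rw [Finset.prod_div_distrib, Finset.prod_pow_eq_pow_sum] at h
    rw [div_eq_iff (pow_ne_zero _ hη)]
    refine h.trans ?_
    ring
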